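/- Let $R>1$ be an integer and let $B,L\subset\mathbb Z$ be finite sets with $0\in B$, $0\in L$ and $\#B=\#L=N$ such that the matrix $\frac1{\sqrt N}\left(e^{2\pi i R^{-1}bl}\right)_{b\in B,\,l\in L}$ is unitary. For $b\in\mathbb Z$ put $\tau_b(x)=R^{-1}(x+b)$, $x\in\mathbb R$. Let $X_B=\left\{\sum_{k\ge1}R^{-k}b_k : b_k\in B\right\}$ be the attractor of the maps $(\tau_b)_{b\in B}$, and let $\mu$ be the unique Borel probability measure on $\mathbb R$ with $\mu(E)=\frac1N\sum_{b\in B}\mu(\tau_b^{-1}(E))$ for all Borel sets $E$. Put $m_B(x)=\frac1N\sum_{b\in B}e^{2\pi i bx}$ and $m_L(x)=\frac1N\sum_{l\in L}e^{2\pi i lx}$. An extreme $L$-cycle is a set $C=\{x_0,\dots,x_{p-1}\}\subset\mathbb R$, $p\ge1$, for which there are $l_0,\dots,l_{p-1}\in L$ with $R^{-1}(x_i+l_i)=x_{i+1}$ for $0\le i<p$ (where $x_p=x_0$) and $|m_B(x_i)|=1$ for all $i$. Let $\Lambda_0$ be the union of the sets $-C$ over all extreme $L$-cycles $C$, and let $\Lambda_{n+1}=R\Lambda_n+L$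 for $n\ge0$ (these sets are finite). Put $$D_n(x)=\sum_{\lambda\in\Lambda_n}e^{2\pi i\lambda x},\qquad \|D_n\|_1=\int|D_n|\,d\mu,\qquad s_n(f;x)=\sum_{\lambda\in\Lambda_n}\left(\int f(y)e^{-2\pi i\lambda y}\,d\mu(y)\right)e^{2\pi i\lambda x}.$$ For functions $f$ on $X_B$ define the Ruelle operator $(R_Lf)(x)=\sum_{b\in B}|m_L(\tau_bx)|\,f(\tau_bx)$, $x\in X_B$. Then the limit $$\mathfrak D=\lim_{n\to\infty}\left(\sup_{x\in X_B}(R_L^n1)(x)\right)^{1/n}$$ exists in $\mathbb R$, and the following hold. 1. If $\mathfrak D>1$, then for each $\rho$ with $1<\rho\le\mathfrak D$ there is a constant $C>0$ such that $\|D_n\|_1\ge C\rho^n$ for all sufficiently large $n$; moreover, there is a continuous function $f:X_B\to\mathbb C$ such that the sequence $(s_n(f;0))_n$ is unbounded. 2. Conversely, if there are $\rho>1$ and $C>0$ such that $\|D_n\|_1\ge C\rho^n$ for all sufficiently large $n$, then $\mathfrak D>1$. -/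

import Mathlib

open Filter Topology MeasureTheory

/-- The exponential function `e_t(x) = e^{2πitx}`. -/
noncomputable def expo (t x : ℝ) : ℂ :=
  Complex.exp (2 * Real.pi * Complex.I * t * x)

/-- The matrix `N^{-1/2} (e^{2πi R⁻¹ b l})_{b ∈ B, l ∈ L}`, where `N` is the cardinality of `B`. -/
noncomputable def hadamardMatrix (R : ℕ) (B L : Finset ℤ) : Matrix B L ℂ :=
  Matrix.of fun b l => ((Real.sqrt B.card)⁻¹ : ℂ) * expo ((R : ℝ)⁻¹ * (b : ℤ)) (l : ℤ)

/-- The standing data: an integer `R > 1` and finite sets `B, L` of integers of the same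
cardinality, both containing `0`, that form a Hadamard pair (the matrix above is unitary). -/
structure HadamardSystem where
  R : ℕ
  B : Finset ℤ
  L : Finset ℤ
  one_lt_R : 1 < R
  zero_mem_B : (0 : ℤ) ∈ B
  zero_mem_L : (0 : ℤ) ∈ L
  card_eq : B.card = L.card
  unitary_left : hadamardMatrix R B L * (hadamardMatrix R B L).conjTranspose = 1
  unitary_right : (hadamardMatrix R B L).conjTranspose * hadamardMatrix R B L = 1

namespace HadamardSystem

variable (T : HadamardSystem)

/-- The common cardinality of `B` and `L`. -/
def N : ℕ := T.B.card

instance : Nonempty T.B := ⟨⟨0, T.zero_mem_B⟩⟩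

/-- The maps `τ_b(x) = R⁻¹ (x + b)` (used for `b ∈ B`, and as `σ_l` for `l ∈ L`). -/
noncomputable def tau (b : ℤ) (x : ℝ) : ℝ := (T.R : ℝ)⁻¹ * (x + b)

/-- The encoding map `(b₁, b₂, …) ↦ ∑_{k ≥ 1} R^{-k} b_k` on sequences of digits in `B`. -/
noncomputable def encode (w : ℕ → T.B) : ℝ :=
  ∑' k : ℕ, ((T.R : ℝ)⁻¹) ^ (k + 1) * ((w k : ℤ) : ℝ)

/-- The attractor `X_B = {∑_{k ≥ 1} R^{-k} b_k : b_k ∈ B}` of the maps `τ_b`, `b ∈ B`. -/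
def attractor : Set ℝ := Set.range T.encode

/-- The invariant measure `μ_B`: the law of `∑_{k ≥ 1} R^{-k} b_k` for independent digits `b_k`,
uniformly distributed in `B`. It is characterized as the unique invariant Borel probability
measure in `existsUnique_invariant` below. -/
noncomputable def mu : Measure ℝ :=
  (Measure.infinitePi fun _ : ℕ => ProbabilityTheory.uniformOn (Set.univ : Set T.B)).map T.encode

/-- `m_B(x) = N⁻¹ ∑_{b ∈ B} e^{2πibx}`. -/
noncomputable def mB (x : ℝ) : ℂ := (T.N : ℂ)⁻¹ * ∑ b ∈ T.B, expo b x

/-- `m_L(x) = N⁻¹ ∑_{l ∈ L} e^{2πilx}`. -/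
noncomputable def mL (x : ℝ) : ℂ := (T.N : ℂ)⁻¹ * ∑ l ∈ T.L, expo l x

/-- `C = {x_0, …, x_{p-1}}` is an `L`-cycle: there are `l_0, …, l_{p-1} ∈ L` such that
`R⁻¹(x_i + l_i) = x_{i+1}` for `i < p`, where `x_p = x_0`. -/
def IsCycle (C : Set ℝ) : Prop :=
  ∃ (p : ℕ) (x : ℕ → ℝ) (l : ℕ → ℤ), 0 < p ∧ x p = x 0 ∧
    (∀ i < p, l i ∈ T.L ∧ T.tau (l i) (x i) = x (i + 1)) ∧ C = x '' Set.Iio p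

/-- An `L`-cycle is extreme if `|m_B| = 1` at all its points. -/
def IsExtremeCycle (C : Set ℝ) : Prop :=
  T.IsCycle C ∧ ∀ x ∈ C, ‖T.mB x‖ = 1

/-- `Λ_0 = ⋃ {-C : C an extreme L-cycle}`, `Λ_{n+1} = R Λ_n + L`. -/
def freq : ℕ → Set ℝ
  | 0 => {y | ∃ C, T.IsExtremeCycle C ∧ -y ∈ C}
  | n + 1 => {y | ∃ a ∈ freq n, ∃ l ∈ T.L, y = T.R * a + l}

section Facts

lemma R_pos : (0 : ℝ) < T.R := by exact_mod_cast (zero_lt_one.trans T.one_lt_R)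

lemma one_lt_R' : (1 : ℝ) < T.R := by exact_mod_cast T.one_lt_R

lemma N_pos : 0 < T.N := Finset.card_pos.2 ⟨0, T.zero_mem_B⟩

lemma exists_bound (F : Finset ℤ) : ∃ M : ℝ, 0 ≤ M ∧ ∀ b ∈ F, |(b : ℝ)| ≤ M :=
  ⟨∑ b ∈ F, |((b : ℤ) : ℝ)|, Finset.sum_nonneg fun _ _ => abs_nonneg _, fun b hb =>
    Finset.single_le_sum (f := fun c : ℤ => |(c : ℝ)|) (fun _ _ => abs_nonneg _) hb⟩

lemma inv_R_lt_one : (T.R : ℝ)⁻¹ < 1 := inv_lt_one_of_one_lt₀ T.one_lt_R'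

lemma inv_R_nonneg : 0 ≤ (T.R : ℝ)⁻¹ := inv_nonneg.2 T.R_pos.le

lemma summable_bound (M : ℝ) : Summable fun k : ℕ => ((T.R : ℝ)⁻¹) ^ (k + 1) * M :=
  (((summable_nat_add_iff 1).2
    (summable_geometric_of_lt_one T.inv_R_nonneg T.inv_R_lt_one))).mul_right M

lemma summable_encode (w : ℕ → T.B) :
    Summable fun k : ℕ => ((T.R : ℝ)⁻¹) ^ (k + 1) * ((w k : ℤ) : ℝ) := by
  obtain ⟨M, _, hM⟩ := exists_bound T.B
  refine Summable.of_norm_bounded (T.summable_bound M) fun k => ?_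
  rw [norm_mul, Real.norm_of_nonneg (pow_nonneg T.inv_R_nonneg _)]
  exact mul_le_mul_of_nonneg_left (hM _ (w k).2) (pow_nonneg T.inv_R_nonneg _)

lemma continuous_encode : Continuous T.encode := by
  obtain ⟨M, _, hM⟩ := exists_bound T.B
  refine continuous_tsum (u := fun k : ℕ => ((T.R : ℝ)⁻¹) ^ (k + 1) * M) (fun k => ?_)
    (T.summable_bound M) fun k w => ?_
  · exact continuous_const.mul
      ((continuous_of_discreteTopology (f := fun b : T.B => ((b : ℤ) : ℝ))).comp
        (continuous_apply k))
  · rw [norm_mul, Real.norm_of_nonneg (pow_nonneg T.inv_R_nonneg _)]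
    exact mul_le_mul_of_nonneg_left (hM _ (w k).2) (pow_nonneg T.inv_R_nonneg _)

/-- The sequence `b w₁ w₂ …`. -/
def cons (b : T.B) (w : ℕ → T.B) : ℕ → T.B
  | 0 => b
  | k + 1 => w k

lemma encode_cons (b : T.B) (w : ℕ → T.B) : T.encode (T.cons b w) = T.tau b (T.encode w) := by
  rw [encode, (T.summable_encode _).tsum_eq_zero_add, tau, encode, mul_add, ← tsum_mul_left,
    add_comm]
  simp only [cons, pow_succ', pow_zero, mul_one, mul_assoc]

lemma tau_mem {b : ℤ} (hb : b ∈ T.B) {x : ℝ} (hx : x ∈ T.attractor) :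
    T.tau b x ∈ T.attractor := by
  obtain ⟨w, rfl⟩ := hx
  exact ⟨T.cons ⟨b, hb⟩ w, T.encode_cons _ _⟩

/-- The attractor is a compact solution of `X = ⋃_{b ∈ B} τ_b(X)`. -/
lemma isCompact_attractor : IsCompact T.attractor := isCompact_range T.continuous_encode

lemma attractor_eq : T.attractor = ⋃ b ∈ T.B, T.tau b '' T.attractor := by
  ext x
  simp only [Set.mem_iUnion, Set.mem_image]
  constructor
  · rintro ⟨w, rfl⟩
    refine ⟨w 0, (w 0).2, T.encode fun k => w (k + 1), ⟨_, rfl⟩, ?_⟩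
    rw [← T.encode_cons]
    congr 1
    funext k
    cases k <;> rfl
  · rintro ⟨b, hb, y, hy, rfl⟩
    exact T.tau_mem hb hy

instance : Nonempty T.attractor := ⟨⟨_, ⟨fun _ => Classical.arbitrary _, rfl⟩⟩⟩

lemma norm_expo (t x : ℝ) : ‖expo t x‖ = 1 := by
  have : (2 * Real.pi * Complex.I * t * x : ℂ) = ((2 * Real.pi * t * x : ℝ) : ℂ) * Complex.I := by
    push_cast; ring
  rw [expo, this, Complex.norm_exp_ofReal_mul_I]

lemma mul_mem_int_of_norm_mB {y : ℝ} (hy : ‖T.mB y‖ = 1) {b : ℤ} (hb : b ∈ T.B) :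
    ∃ k : ℤ, (b : ℝ) * y = k := by
  by_cases hb0 : b = 0
  · exact ⟨0, by simp [hb0]⟩
  have hN : (0 : ℝ) < T.N := by exact_mod_cast T.N_pos
  have h1 : expo b y = 1 := by
    by_contra hne
    have hsum : ‖∑ b ∈ T.B, expo b y‖ = T.N := by
      rw [mB, norm_mul, norm_inv, Complex.norm_natCast] at hy
      field_simp at hy
      exact hy
    have h0 : (0 : ℤ) ∈ T.B.erase b := Finset.mem_erase.2 ⟨Ne.symm hb0, T.zero_mem_B⟩
    have hz : expo ((0 : ℤ) : ℝ) y = 1 := by simp [expo]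
    rw [← Finset.add_sum_erase _ _ hb, ← Finset.add_sum_erase _ _ h0, ← add_assoc, hz] at hsum
    have hlt : ‖expo b y + 1‖ < ‖expo b y‖ + ‖(1 : ℂ)‖ :=
      norm_add_lt_of_not_sameRay fun h =>
        hne (h.eq_of_norm_eq (by rw [norm_expo, norm_one]))
    rw [norm_expo, norm_one] at hlt
    have hrest : ‖∑ c ∈ (T.B.erase b).erase 0, expo c y‖ ≤ (T.N : ℝ) - 2 := by
      refine (norm_sum_le _ _).trans ?_
      simp only [norm_expo, Finset.sum_const, nsmul_eq_mul, mul_one]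
      have e1 := Finset.card_erase_add_one hb
      have e2 := Finset.card_erase_add_one h0
      have : ((T.B.erase b).erase 0).card + 2 = T.N := by
        change _ = T.B.card
        omega
      rw [← this]; push_cast; linarith
    have := norm_add_le (expo b y + 1) (∑ c ∈ (T.B.erase b).erase 0, expo c y)
    linarith
  obtain ⟨k, hk⟩ := Complex.exp_eq_one_iff.1 h1
  refine ⟨k, ?_⟩
  have hpi : (2 * Real.pi * Complex.I : ℂ) ≠ 0 := Complex.two_pi_I_ne_zero
  have : (2 * Real.pi * Complex.I : ℂ) * (b * y) = (2 * Real.pi * Complex.I) * k := by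
    rw [mul_comm _ (k : ℂ), ← hk]; push_cast; ring
  exact_mod_cast mul_left_cancel₀ hpi this

lemma abs_le_of_cycle {C : Set ℝ} (hC : T.IsCycle C) {M : ℝ}
    (hM : ∀ l ∈ T.L, |(l : ℝ)| ≤ M) {y : ℝ} (hy : y ∈ C) : |y| ≤ M := by
  obtain ⟨p, x, l, hp, hper, hx, rfl⟩ := hC
  obtain ⟨i, hi, rfl⟩ := hy
  have hR : (2 : ℝ) ≤ T.R := by exact_mod_cast T.one_lt_R
  obtain ⟨j, hj, hmax⟩ := Finset.exists_max_image (Finset.range p) (fun i => |x i|)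
    ⟨0, Finset.mem_range.2 hp⟩
  have hstep : ∀ i < p, (T.R : ℝ) * |x (i + 1)| ≤ |x i| + M := fun i hi => by
    obtain ⟨hl, he⟩ := hx i hi
    have : (T.R : ℝ) * x (i + 1) = x i + l i := by
      rw [← he, tau, mul_inv_cancel_left₀ T.R_pos.ne']
    rw [← abs_of_pos T.R_pos, ← abs_mul, this]
    exact (abs_add_le _ _).trans (by linarith [hM _ hl])
  have hpred : ∃ i < p, |x j| = |x (i + 1)| := by
    rcases Nat.eq_zero_or_pos j with rfl | hj0
    · exact ⟨p - 1, by omega, by rw [Nat.sub_add_cancel hp, hper]⟩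
    · exact ⟨j - 1, by have := Finset.mem_range.1 hj; omega, by rw [Nat.sub_add_cancel hj0]⟩
  obtain ⟨i', hi', he'⟩ := hpred
  have h1 := hstep i' hi'
  rw [← he'] at h1
  have h2 := hmax i' (Finset.mem_range.2 hi')
  have h3 := hmax i (Finset.mem_range.2 hi)
  have h4 : (2 : ℝ) * |x j| ≤ T.R * |x j| := mul_le_mul_of_nonneg_right hR (abs_nonneg _)
  linarith

/-- The sets `Λ_n` are finite. -/
lemma finite_freq (n : ℕ) : (T.freq n).Finite := by
  induction n with
  | zero =>
    obtain ⟨M, _, hM⟩ := exists_bound T.L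
    by_cases hB : ∃ b ∈ T.B, b ≠ 0
    · obtain ⟨b, hb, hb0⟩ := hB
      have hb0' : (b : ℝ) ≠ 0 := by exact_mod_cast hb0
      refine ((Set.finite_Icc (-⌈|(b : ℝ)| * M⌉) ⌈|(b : ℝ)| * M⌉).image
        fun k : ℤ => -((k : ℝ) / b)).subset ?_
      rintro y ⟨C, ⟨hC, hC1⟩, hy⟩
      obtain ⟨k, hk⟩ := T.mul_mem_int_of_norm_mB (hC1 _ hy) hb
      have habs := T.abs_le_of_cycle hC hM hy
      refine ⟨k, ?_, by simp only; rw [← hk]; field_simp⟩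
      have : |(k : ℝ)| ≤ ⌈|(b : ℝ)| * M⌉ := by
        rw [← hk, abs_mul]
        exact (mul_le_mul_of_nonneg_left habs (abs_nonneg _)).trans (Int.le_ceil _)
      rw [abs_le] at this
      exact ⟨by exact_mod_cast this.1, by exact_mod_cast this.2⟩
    · push Not at hB
      have hcard : T.L.card ≤ 1 := by
        rw [← T.card_eq, Finset.card_le_one]
        intro a ha b hb
        rw [hB a ha, hB b hb]
      have hL : ∀ l ∈ T.L, l = 0 := fun l hl => Finset.card_le_one.1 hcard _ hl _ T.zero_mem_L
      refine (Set.finite_singleton 0).subset ?_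
      rintro y ⟨C, ⟨hC, _⟩, hy⟩
      have := T.abs_le_of_cycle (M := 0) hC (fun l hl => by simp [hL l hl]) hy
      simpa using this
  | succ n ih =>
    refine ((ih.image2 (fun a (l : ℤ) => (T.R : ℝ) * a + l) T.L.finite_toSet)).subset ?_
    rintro y ⟨a, ha, l, hl, rfl⟩
    exact ⟨a, ha, l, hl, rfl⟩

lemma measurable_cons : Measurable fun q : T.B × (ℕ → T.B) => T.cons q.1 q.2 := by
  refine measurable_pi_lambda _ fun k => ?_
  cases k with
  | zero => exact measurable_fst
  | succ k => exact (measurable_pi_apply k).comp measurable_snd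

/-- Adding an independent uniform digit in front preserves the law of the digit sequence. -/
lemma map_cons :
    ((ProbabilityTheory.uniformOn (Set.univ : Set T.B)).prod
      (Measure.infinitePi fun _ : ℕ => ProbabilityTheory.uniformOn (Set.univ : Set T.B))).map
        (fun q => T.cons q.1 q.2) =
      Measure.infinitePi fun _ : ℕ => ProbabilityTheory.uniformOn (Set.univ : Set T.B) := by
  set U := ProbabilityTheory.uniformOn (Set.univ : Set T.B)
  refine Measure.eq_infinitePi _ fun s t ht => ?_
  obtain ⟨n, hn⟩ : ∃ n, s ⊆ Finset.range (n + 1) :=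
    ⟨s.sup id, fun i hi => Finset.mem_range.2 (Nat.lt_succ_of_le (Finset.le_sup (f := id) hi))⟩
  set a : ℕ → Set T.B := fun i => if i ∈ s then t i else Set.univ with ha
  have hpi : Set.pi s t = Set.pi (Finset.range (n + 1)) a := by
    ext w
    simp only [Set.mem_pi, ha]
    constructor
    · intro h i _
      split_ifs with hi
      · exact h i hi
      · trivial
    · intro h i hi
      have := h i (hn hi)
      rwa [if_pos (Finset.mem_coe.1 hi)] at this
  have hprod : ∏ i ∈ s, U (t i) = ∏ i ∈ Finset.range (n + 1), U (a i) := by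
    rw [← Finset.prod_subset hn (f := fun i => U (a i))]
    · exact Finset.prod_congr rfl fun i hi => by simp only [ha, if_pos hi]
    · intro i _ hi
      simp only [ha, if_neg hi, measure_univ]
  have hpre : (fun q : T.B × (ℕ → T.B) => T.cons q.1 q.2) ⁻¹' Set.pi (Finset.range (n + 1)) a =
      a 0 ×ˢ Set.pi (Finset.range n) fun k => a (k + 1) := by
    ext ⟨b, w⟩
    simp only [Set.mem_preimage, Set.mem_pi, Set.mem_prod, Finset.coe_range, Set.mem_Iio]
    constructor
    · exact fun h => ⟨h 0 (by omega), fun k hk => h (k + 1) (by omega)⟩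
    · rintro ⟨h0, h1⟩ k hk
      cases k with
      | zero => exact h0
      | succ k => exact h1 k (by omega)
  rw [hpi, hprod, Measure.map_apply T.measurable_cons
    (MeasurableSet.pi (Finset.countable_toSet _) fun _ _ => (Set.toFinite _).measurableSet), hpre,
    Measure.prod_prod, Measure.infinitePi_pi _ fun _ _ => (Set.toFinite _).measurableSet,
    Finset.prod_range_succ', mul_comm]

instance : IsProbabilityMeasure T.mu :=
  Measure.isProbabilityMeasure_map T.continuous_encode.measurable.aemeasurable

lemma measurable_tau (b : ℤ) : Measurable (T.tau b) := by
  unfold tau; fun_prop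

lemma mu_invariant {E : Set ℝ} (hE : MeasurableSet E) :
    T.mu E = (T.N : ENNReal)⁻¹ * ∑ b ∈ T.B, T.mu (T.tau b ⁻¹' E) := by
  have he := T.continuous_encode.measurable
  have hpre : MeasurableSet (T.encode ⁻¹' E) := he hE
  rw [mu, Measure.map_apply he hE]
  conv_lhs => rw [← T.map_cons]
  rw [Measure.map_apply T.measurable_cons hpre, Measure.prod_apply (T.measurable_cons hpre),
    lintegral_fintype, ← Finset.sum_coe_sort T.B fun b => (Measure.map T.encode (Measure.infinitePi fun _ : ℕ =>
      ProbabilityTheory.uniformOn (Set.univ : Set T.B)) (T.tau b ⁻¹' E)), Finset.mul_sum]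
  refine Finset.sum_congr rfl fun b _ => ?_
  rw [Measure.map_apply he (T.measurable_tau b hE), mul_comm]
  congr 1
  · rw [ProbabilityTheory.uniformOn_univ]
    simp [N]
  · congr 1
    ext w
    simp [T.encode_cons]

lemma charFun_of_invariant {ν : Measure ℝ} [IsProbabilityMeasure ν]
    (h : ∀ E, MeasurableSet E → ν E = (T.N : ENNReal)⁻¹ * ∑ b ∈ T.B, ν (T.tau b ⁻¹' E)) (t : ℝ) :
    charFun ν t = ((T.N : ℂ)⁻¹ * ∑ b ∈ T.B, Complex.exp (((T.R : ℝ)⁻¹ * t * b : ℝ) * Complex.I)) *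
      charFun ν ((T.R : ℝ)⁻¹ * t) := by
  have hν : ν = (T.N : ENNReal)⁻¹ • ∑ b ∈ T.B, ν.map (T.tau b) := by
    ext E hE
    rw [h E hE]
    simp only [Measure.smul_apply, Measure.finsetSum_apply, smul_eq_mul]
    congr 1
    exact Finset.sum_congr rfl fun b _ => (Measure.map_apply (T.measurable_tau b) hE).symm
  have hint : ∀ b ∈ T.B, Integrable (fun x : ℝ => Complex.exp (t * x * Complex.I))
      (ν.map (T.tau b)) := fun b _ => by
    have := Measure.isProbabilityMeasure_map (μ := ν) (T.measurable_tau b).aemeasurable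
    refine Integrable.of_bound (C := 1) (by fun_prop) (Eventually.of_forall fun x => ?_)
    rw [← Complex.ofReal_mul, Complex.norm_exp_ofReal_mul_I]
  conv_lhs => rw [hν]
  rw [charFun_apply_real, integral_smul_measure, integral_finsetSum_measure hint, mul_assoc,
    Finset.sum_mul, Complex.real_smul, ENNReal.toReal_inv, ENNReal.toReal_natCast]
  push_cast
  congr 1
  refine Finset.sum_congr rfl fun b _ => ?_
  rw [integral_map (T.measurable_tau b).aemeasurable (by fun_prop), charFun_apply_real,
    ← integral_const_mul]
  congr 1
  funext x
  rw [← Complex.exp_add, tau]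
  congr 1
  push_cast
  ring

lemma norm_factor_le_one (u : ℝ) :
    ‖(T.N : ℂ)⁻¹ * ∑ b ∈ T.B, Complex.exp ((u * b : ℝ) * Complex.I)‖ ≤ 1 := by
  have hN : (0 : ℝ) < T.N := by exact_mod_cast T.N_pos
  rw [norm_mul, norm_inv, Complex.norm_natCast, inv_mul_le_iff₀ hN, mul_one]
  refine (norm_sum_le _ _).trans (le_of_eq ?_)
  simp only [Complex.norm_exp_ofReal_mul_I]
  simp [N]

/-- `μ_B` is the unique invariant Borel probability measure. -/
theorem existsUnique_invariant :
    ∃! ν : Measure ℝ, IsProbabilityMeasure ν ∧ ∀ E, MeasurableSet E →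
      ν E = (T.N : ENNReal)⁻¹ * ∑ b ∈ T.B, ν (T.tau b ⁻¹' E) := by
  refine ⟨T.mu, ⟨inferInstance, fun E hE => T.mu_invariant hE⟩, ?_⟩
  rintro ν ⟨hν, h⟩
  refine Measure.ext_of_charFun (funext fun t => ?_)
  have hle : ∀ t, ‖charFun ν t - charFun T.mu t‖ ≤
      ‖charFun ν ((T.R : ℝ)⁻¹ * t) - charFun T.mu ((T.R : ℝ)⁻¹ * t)‖ := fun t => by
    rw [T.charFun_of_invariant h, T.charFun_of_invariant (fun E hE => T.mu_invariant hE) t,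
      ← mul_sub, norm_mul]
    exact mul_le_of_le_one_left (norm_nonneg _) (T.norm_factor_le_one _)
  have hle' : ∀ n : ℕ, ‖charFun ν t - charFun T.mu t‖ ≤
      ‖charFun ν (((T.R : ℝ)⁻¹) ^ n * t) - charFun T.mu (((T.R : ℝ)⁻¹) ^ n * t)‖ := fun n => by
    induction n with
    | zero => simp
    | succ n ih => rw [pow_succ', mul_assoc]; exact ih.trans (hle _)
  have hlim : Tendsto (fun n : ℕ => ((T.R : ℝ)⁻¹) ^ n * t) atTop (𝓝 0) := by
    simpa using (tendsto_pow_atTop_nhds_zero_of_lt_one T.inv_R_nonneg T.inv_R_lt_one).mul_const t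
  have hc : Continuous fun t => ‖charFun ν t - charFun T.mu t‖ :=
    (continuous_charFun.sub continuous_charFun).norm
  have h0 := (hc.tendsto 0).comp hlim
  simp only [charFun_zero, probReal_univ, sub_self, norm_zero] at h0
  have := ge_of_tendsto' h0 hle'
  exact sub_eq_zero.1 (norm_le_zero_iff.1 this)

end Facts
/-- The Dirichlet kernel `D_n(x) = ∑_{λ ∈ Λ_n} e^{2πiλx}`. -/
noncomputable def dirichletKernel (n : ℕ) (x : ℝ) : ℂ :=
  ∑ a ∈ (T.finite_freq n).toFinset, expo a x

/-- `‖D_n‖_1 = ∫ |D_n| dμ_B`. -/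
noncomputable def dirichletNorm (n : ℕ) : ℝ := ∫ x, ‖T.dirichletKernel n x‖ ∂T.mu

/-- `s_n(f; x) = ∑_{λ ∈ Λ_n} (∫ f(y) e^{-2πiλy} dμ_B(y)) e^{2πiλx}`. -/
noncomputable def partialSum (f : ℝ → ℂ) (n : ℕ) (x : ℝ) : ℂ :=
  ∑ a ∈ (T.finite_freq n).toFinset, (∫ y, f y * expo (-a) y ∂T.mu) * expo a x

/-- The Ruelle operator `(R_L f)(x) = ∑_{b ∈ B} |m_L(τ_b x)| f(τ_b x)` on functions on `X_B`. -/
noncomputable def ruelle (f : T.attractor → ℝ) (x : T.attractor) : ℝ :=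
  ∑ b : T.B, ‖T.mL (T.tau b x)‖ * f ⟨T.tau b x, T.tau_mem b.2 x.2⟩

lemma norm_mL_le_one (x : ℝ) : ‖T.mL x‖ ≤ 1 := by
  have hN : (0 : ℝ) < T.N := by exact_mod_cast T.N_pos
  rw [mL, norm_mul, norm_inv, Complex.norm_natCast, inv_mul_le_iff₀ hN, mul_one]
  refine (norm_sum_le _ _).trans (le_of_eq ?_)
  simp [norm_expo, N, T.card_eq]

/-- The suprema of the functions `R_L^n 1` over `X_B` are finite. -/
lemma ruelle_iterate_one_mem (n : ℕ) (x : T.attractor) :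
    (T.ruelle^[n] fun _ => 1) x ∈ Set.Icc (0 : ℝ) (T.N ^ n) := by
  induction n generalizing x with
  | zero => simp
  | succ n ih =>
    rw [Function.iterate_succ_apply']
    refine ⟨Finset.sum_nonneg fun b _ => mul_nonneg (norm_nonneg _) (ih _).1, ?_⟩
    calc T.ruelle (T.ruelle^[n] fun _ => 1) x ≤ ∑ _b : T.B, (T.N : ℝ) ^ n :=
          Finset.sum_le_sum fun b _ => (mul_le_of_le_one_left (ih _).1 (T.norm_mL_le_one _)).trans
            (ih _).2
      _ = (T.N : ℝ) ^ (n + 1) := by simp [N, pow_succ']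

lemma bddAbove_ruelle (n : ℕ) :
    BddAbove (Set.range (T.ruelle^[n] fun _ => 1)) :=
  ⟨T.N ^ n, by rintro _ ⟨x, rfl⟩; exact (T.ruelle_iterate_one_mem n x).2⟩

end HadamardSystem

/-! The engine is a duality. At points of extreme cycles `|m_B| = 1` forces `λ b ∈ ℤ` for `b ∈ B`,
and this integrality passes to every `Λ_n`. Hence `D_n(x + b) = D_n(x)`, and the Hadamard condition
makes `(λ, l) ↦ R λ + l` injective, so `D_{n+1}(x) = N m_L(x) D_n(R x)`. Invariance of `μ` turns
this into `‖D_n‖_1 = ∫ |D_0| R_L^n 1 dμ` (`dirichletNorm_eq`).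

Positivity of `R_L` makes `sup R_L^n 1` submultiplicative, so Fekete's lemma gives the limit `D`
together with `D^n ≤ sup R_L^n 1`. The upper bound `‖D_n‖_1 ≤ #Λ_0 sup R_L^n 1` yields the converse.

For the lower bound the supremum must be nearly attained on a set that `|D_0| dμ` charges uniformly
in `n`. No eigenfunction is constructed. Instead, the resolvents `h = ∑ s^{-n-1} R_L^n 1` are
studied as `s ↓ D`: they blow up, while a Lasota-Yorke estimate bounds the Lipschitz constant of `h
/ sup h` independently of `s`. So `h` is comparable to its supremum on a ball of fixed radius, and
iterating `s h = 1 + R_L h` transfers this to `R_L^n 1 ≥ D^n / 4` there (`exists_ball_le_iter`).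
Since `μ` has full support on the perfect set `X_B` and `D_0` is analytic and nonzero, compactness
bounds the integral of `|D_0|` over such balls from below.

Finally `s_n(f; 0)` is integration of `f` against the conjugate of `D_n`, so unbounded `‖D_n‖_1` and
Banach-Steinhaus give the divergent `f`. -/

lemma expo_add_left (s t x : ℝ) : expo (s + t) x = expo s x * expo t x := by
  rw [expo, expo, expo, ← Complex.exp_add]; congr 1; push_cast; ring

lemma expo_add_right (t x y : ℝ) : expo t (x + y) = expo t x * expo t y := by
  rw [expo, expo, expo, ← Complex.exp_add]; congr 1; push_cast; ring

lemma expo_mul_left (s t x : ℝ) : expo (s * t) x = expo t (s * x) := by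
  rw [expo, expo]; congr 1; push_cast; ring

lemma expo_eq_one_of_mul_eq_int {t x : ℝ} {k : ℤ} (h : t * x = k) : expo t x = 1 := by
  rw [expo, Complex.exp_eq_one_iff]
  refine ⟨k, ?_⟩
  have : (t * x : ℂ) = k := by exact_mod_cast h
  rw [← this]; ring

lemma expo_neg_left (t x : ℝ) : expo (-t) x = (starRingEnd ℂ) (expo t x) := by
  rw [expo, expo, ← Complex.exp_conj]
  congr 1
  simp [map_ofNat]

lemma expo_zero_right (t : ℝ) : expo t 0 = 1 := by simp [expo]

@[fun_prop]
lemma continuous_expo (t : ℝ) : Continuous (expo t) := by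
  unfold expo; fun_prop

lemma analyticAt_expo (t x : ℝ) : AnalyticAt ℝ (expo t) x := by
  have h : AnalyticAt ℝ (fun y : ℝ => (2 * Real.pi * Complex.I * t : ℂ) * y) x :=
    analyticAt_const.mul (Complex.ofRealCLM.analyticAt x)
  exact (analyticAt_cexp.restrictScalars (𝕜 := ℝ)).comp h

lemma norm_expo_sub_le (t x y : ℝ) :
    ‖expo t x - expo t y‖ ≤ 2 * Real.pi * |t| * |x - y| := by
  have h : expo t x - expo t y = expo t y * (Complex.exp (Complex.I * (2 * Real.pi * t * (x - y) : ℝ)) - 1) := by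
    rw [mul_sub, mul_one, expo, expo, ← Complex.exp_add]
    congr 2
    push_cast; ring
  rw [h, norm_mul, HadamardSystem.norm_expo, one_mul]
  refine (Real.norm_exp_I_mul_ofReal_sub_one_le).trans (le_of_eq ?_)
  rw [Real.norm_eq_abs, abs_mul, abs_mul, abs_of_pos (by positivity : 0 < 2 * Real.pi)]

namespace HadamardSystem

variable (T : HadamardSystem)

/-! ### Arithmetic of the frequencies and recursion for the Dirichlet kernels. -/

lemma mul_int_of_mem_freq {b : ℤ} (hb : b ∈ T.B) {n : ℕ} {a : ℝ} (ha : a ∈ T.freq n) :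
    ∃ k : ℤ, a * b = k := by
  induction n generalizing a with
  | zero =>
    obtain ⟨C, hC, haC⟩ := ha
    obtain ⟨k, hk⟩ := T.mul_mem_int_of_norm_mB (hC.2 _ haC) hb
    exact ⟨-k, by push_cast; rw [← hk]; ring⟩
  | succ n ih =>
    obtain ⟨c, hc, l, hl, rfl⟩ := ha
    obtain ⟨k, hk⟩ := ih hc
    exact ⟨T.R * k + l * b, by push_cast; rw [← hk]; ring⟩

/-- Distinct columns of the Hadamard matrix are orthogonal. -/
lemma sum_expo_eq_zero {l l' : ℤ} (hl : l ∈ T.L) (hl' : l' ∈ T.L) (h : l ≠ l') :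
    ∑ b ∈ T.B, expo (((l' : ℝ) - l) / T.R) b = 0 := by
  have hN : (0 : ℝ) < T.B.card := by exact_mod_cast T.N_pos
  have h1 := congrFun (congrFun T.unitary_right ⟨l, hl⟩) ⟨l', hl'⟩
  rw [Matrix.one_apply_ne (by simpa using h), Matrix.mul_apply] at h1
  have h2 : ∑ b : T.B, expo (((l' : ℝ) - l) / T.R) b = T.B.card * ∑ b : T.B,
      (hadamardMatrix T.R T.B T.L).conjTranspose ⟨l, hl⟩ b * hadamardMatrix T.R T.B T.L b ⟨l', hl'⟩ := by
    rw [Finset.mul_sum]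
    refine Finset.sum_congr rfl fun b _ => ?_
    have hs : ((Real.sqrt T.B.card : ℝ) : ℂ) * (Real.sqrt T.B.card : ℝ) = T.B.card := by
      rw [← Complex.ofReal_mul, Real.mul_self_sqrt hN.le]; simp
    have hs0 : ((Real.sqrt T.B.card : ℝ) : ℂ) ≠ 0 := by
      exact_mod_cast (Real.sqrt_pos.2 hN).ne'
    have he : expo (((l' : ℝ) - l) / T.R) b =
        (starRingEnd ℂ) (expo ((T.R : ℝ)⁻¹ * (b : ℤ)) l) * expo ((T.R : ℝ)⁻¹ * (b : ℤ)) l' := by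
      rw [← expo_neg_left, expo, expo, expo, ← Complex.exp_add]
      congr 1; push_cast; field_simp; ring
    simp only [hadamardMatrix, Matrix.conjTranspose_apply, Matrix.of_apply, star_mul',
      RCLike.star_def, map_inv₀, Complex.conj_ofReal]
    rw [he, ← hs]
    field_simp
  rw [Finset.sum_coe_sort T.B fun b => expo (((l' : ℝ) - l) / T.R) b] at h2
  rw [h2, h1, mul_zero]

/-- If `l ≠ l'`, then `(l' - l)/R = a - a'`, whose products with all `b ∈ B` are integers. Every
term of the vanishing sum from column orthogonality is then `1`, although the sum has `N > 0` terms.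
-/
lemma injective_step {n : ℕ} {a a' : ℝ} (ha : a ∈ T.freq n) (ha' : a' ∈ T.freq n) {l l' : ℤ}
    (hl : l ∈ T.L) (hl' : l' ∈ T.L) (h : T.R * a + l = T.R * a' + l') : a = a' ∧ l = l' := by
  have hll : l = l' := by
    by_contra hne
    have h0 := T.sum_expo_eq_zero hl hl' hne
    have heq : ((l' : ℝ) - l) / T.R = a - a' := by
      have := T.R_pos
      field_simp; linarith
    rw [Finset.sum_congr rfl (g := fun _ => (1 : ℂ)) fun b hb => ?_] at h0
    · have := T.N_pos
      rw [N] at this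
      simp only [Finset.sum_const, nsmul_eq_mul, mul_one, Nat.cast_eq_zero] at h0
      omega
    · obtain ⟨k, hk⟩ := T.mul_int_of_mem_freq hb ha
      obtain ⟨k', hk'⟩ := T.mul_int_of_mem_freq hb ha'
      refine expo_eq_one_of_mul_eq_int (k := k - k') ?_
      rw [heq]; push_cast; rw [← hk, ← hk']; ring
  subst hll
  exact ⟨mul_left_cancel₀ T.R_pos.ne' (add_right_cancel h), rfl⟩

/-- By `injective_step`, `Λ_{n+1}` is in bijection with `Λ_n × L`, so the exponential sum factors.
-/
lemma dirichletKernel_succ (n : ℕ) (x : ℝ) :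
    T.dirichletKernel (n + 1) x = T.dirichletKernel n (T.R * x) * (T.N * T.mL x) := by
  have hN : (T.N : ℂ) ≠ 0 := by exact_mod_cast T.N_pos.ne'
  rw [mL, mul_inv_cancel_left₀ hN, dirichletKernel, dirichletKernel, Finset.sum_mul_sum,
    ← Finset.sum_product']
  symm
  refine Finset.sum_bij (fun q _ => T.R * q.1 + q.2) ?_ ?_ ?_ ?_
  · rintro ⟨a, l⟩ hq
    simp only [Finset.mem_product, Set.Finite.mem_toFinset] at hq ⊢
    exact ⟨a, hq.1, l, hq.2, rfl⟩
  · rintro ⟨a, l⟩ hq ⟨a', l'⟩ hq' h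
    simp only [Finset.mem_product, Set.Finite.mem_toFinset] at hq hq'
    obtain ⟨h1, h2⟩ := T.injective_step hq.1 hq'.1 hq.2 hq'.2 h
    rw [h1, h2]
  · intro y hy
    obtain ⟨a, ha, l, hl, rfl⟩ := (Set.Finite.mem_toFinset _).1 hy
    exact ⟨(a, l), by simp [ha, hl], rfl⟩
  · rintro ⟨a, l⟩ _
    rw [expo_add_left, expo_mul_left]

lemma dirichletKernel_add {b : ℤ} (hb : b ∈ T.B) (n : ℕ) (x : ℝ) :
    T.dirichletKernel n (x + b) = T.dirichletKernel n x := by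
  refine Finset.sum_congr rfl fun a ha => ?_
  obtain ⟨k, hk⟩ := T.mul_int_of_mem_freq hb ((Set.Finite.mem_toFinset _).1 ha)
  rw [expo_add_right, expo_eq_one_of_mul_eq_int hk, mul_one]

@[fun_prop]
lemma continuous_dirichletKernel (n : ℕ) : Continuous (T.dirichletKernel n) := by
  unfold dirichletKernel; fun_prop

@[fun_prop]
lemma continuous_mL : Continuous T.mL := by
  unfold mL; fun_prop

@[fun_prop]
lemma continuous_tau (b : ℤ) : Continuous (T.tau b) := by
  unfold tau; fun_prop

lemma analyticAt_dirichletKernel (n : ℕ) (x : ℝ) : AnalyticAt ℝ (T.dirichletKernel n) x := by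
  have := Finset.analyticAt_fun_sum (𝕜 := ℝ) (T.finite_freq n).toFinset
    fun a _ => analyticAt_expo a x
  exact this

lemma norm_dirichletKernel_le (n : ℕ) (x : ℝ) :
    ‖T.dirichletKernel n x‖ ≤ (T.finite_freq n).toFinset.card := by
  refine (norm_sum_le _ _).trans (le_of_eq ?_)
  simp [norm_expo]

lemma zero_mem_freq_zero : (0 : ℝ) ∈ T.freq 0 := by
  have hN : (T.N : ℂ) ≠ 0 := by exact_mod_cast T.N_pos.ne'
  refine ⟨{0}, ⟨⟨1, fun _ => 0, fun _ => 0, one_pos, rfl, fun i _ => ⟨T.zero_mem_L, by simp [tau]⟩,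
    ?_⟩, ?_⟩, by simp⟩
  · ext y
    simp
  · rintro x rfl
    have : ∑ b ∈ T.B, expo b 0 = T.N := by simp [expo_zero_right, N]
    rw [mB, this, inv_mul_cancel₀ hN, norm_one]

lemma dirichletKernel_zero_zero_ne : T.dirichletKernel 0 0 ≠ 0 := by
  have : (T.finite_freq 0).toFinset.card ≠ 0 :=
    Finset.card_ne_zero_of_mem ((Set.Finite.mem_toFinset _).2 T.zero_mem_freq_zero)
  simpa [dirichletKernel, expo_zero_right] using this

/-! ### The Ruelle operator as the dual of the kernel recursion. -/

/-- The Ruelle operator, acting on functions on the whole line. -/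
noncomputable def transfer (f : ℝ → ℝ) (x : ℝ) : ℝ :=
  ∑ b ∈ T.B, ‖T.mL (T.tau b x)‖ * f (T.tau b x)

/-- The functions `R_L^n 1`, on the whole line. -/
noncomputable def iter (n : ℕ) : ℝ → ℝ := T.transfer^[n] fun _ => 1

lemma iter_succ (n : ℕ) : T.iter (n + 1) = T.transfer (T.iter n) :=
  Function.iterate_succ_apply' _ _ _

lemma continuous_transfer {f : ℝ → ℝ} (hf : Continuous f) : Continuous (T.transfer f) := by
  unfold transfer; fun_prop

lemma norm_transfer_le {f : ℝ → ℝ} {M : ℝ} (hf : ∀ x, ‖f x‖ ≤ M) (x : ℝ) :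
    ‖T.transfer f x‖ ≤ T.N * M := by
  refine (norm_sum_le _ _).trans ((Finset.sum_le_card_nsmul _ _ M fun b _ => ?_).trans ?_)
  · rw [norm_mul, norm_norm]
    exact (mul_le_of_le_one_left (norm_nonneg _) (T.norm_mL_le_one _)).trans (hf _)
  · rw [nsmul_eq_mul]; rfl

lemma mu_eq_sum_map : T.mu = (T.N : ENNReal)⁻¹ • ∑ b ∈ T.B, T.mu.map (T.tau b) := by
  ext E hE
  rw [T.mu_invariant hE]
  simp only [Measure.smul_apply, Measure.finsetSum_apply, smul_eq_mul]
  congr 1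
  exact Finset.sum_congr rfl fun b _ => (Measure.map_apply (T.measurable_tau b) hE).symm

lemma integral_mu_eq {g : ℝ → ℝ} (hg : Continuous g) {M : ℝ} (hM : ∀ x, ‖g x‖ ≤ M) :
    ∫ x, g x ∂T.mu = (T.N : ℝ)⁻¹ * ∑ b ∈ T.B, ∫ x, g (T.tau b x) ∂T.mu := by
  conv_lhs => rw [T.mu_eq_sum_map]
  rw [integral_smul_measure, integral_finsetSum_measure, ENNReal.toReal_inv,
    ENNReal.toReal_natCast, smul_eq_mul]
  · congr 1
    exact Finset.sum_congr rfl fun b _ =>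
      integral_map (T.measurable_tau b).aemeasurable hg.aestronglyMeasurable
  · intro b _
    have := Measure.isProbabilityMeasure_map (μ := T.mu) (T.measurable_tau b).aemeasurable
    exact Integrable.of_bound hg.aestronglyMeasurable M (Eventually.of_forall hM)

/-- Invariance of `μ` splits the integral along the branches `τ_b`. There `R τ_b x = x + b`, the
shift by `b` is absorbed by periodicity of `D_n`, and the factor `N` of the recursion cancels the
weight `1/N`. -/
lemma integral_dirichletKernel_succ_mul (n : ℕ) {f : ℝ → ℝ} (hf : Continuous f) {M : ℝ}
    (hM : ∀ x, ‖f x‖ ≤ M) :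
    ∫ x, ‖T.dirichletKernel (n + 1) x‖ * f x ∂T.mu =
      ∫ x, ‖T.dirichletKernel n x‖ * T.transfer f x ∂T.mu := by
  have hN : (T.N : ℝ) ≠ 0 := by exact_mod_cast T.N_pos.ne'
  have hM0 : 0 ≤ M := (norm_nonneg _).trans (hM 0)
  rw [T.integral_mu_eq (M := (T.finite_freq (n + 1)).toFinset.card * M) (by fun_prop) fun x => ?_,
    ← integral_finsetSum, ← integral_const_mul]
  · congr 1
    funext x
    rw [transfer, Finset.mul_sum, Finset.mul_sum]
    refine Finset.sum_congr rfl fun b hb => ?_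
    have : (T.R : ℝ) * T.tau b x = x + b := by rw [tau, mul_inv_cancel_left₀ T.R_pos.ne']
    rw [dirichletKernel_succ, this, T.dirichletKernel_add hb, norm_mul, norm_mul,
      Complex.norm_natCast]
    field_simp
  · intro b _
    refine Integrable.of_bound (by fun_prop) ((T.finite_freq (n + 1)).toFinset.card * M)
      (Eventually.of_forall fun x => ?_)
    rw [norm_mul, norm_norm]
    exact mul_le_mul (T.norm_dirichletKernel_le _ _) (hM _) (norm_nonneg _) (Nat.cast_nonneg _)
  · rw [norm_mul, norm_norm]
    exact mul_le_mul (T.norm_dirichletKernel_le _ _) (hM _) (norm_nonneg _) (Nat.cast_nonneg _)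

lemma integral_dirichletKernel_mul (n : ℕ) {f : ℝ → ℝ} (hf : Continuous f) {M : ℝ}
    (hM : ∀ x, ‖f x‖ ≤ M) :
    ∫ x, ‖T.dirichletKernel n x‖ * f x ∂T.mu =
      ∫ x, ‖T.dirichletKernel 0 x‖ * T.transfer^[n] f x ∂T.mu := by
  induction n generalizing f M with
  | zero => rfl
  | succ n ih =>
    rw [T.integral_dirichletKernel_succ_mul n hf hM, Function.iterate_succ_apply]
    exact ih (T.continuous_transfer hf) (T.norm_transfer_le hM)

lemma dirichletNorm_eq (n : ℕ) :
    T.dirichletNorm n = ∫ x, ‖T.dirichletKernel 0 x‖ * T.iter n x ∂T.mu := by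
  have := T.integral_dirichletKernel_mul n (f := fun _ => 1) continuous_const (M := 1) (by simp)
  simp only [mul_one] at this
  exact this

lemma continuous_iter (n : ℕ) : Continuous (T.iter n) := by
  induction n with
  | zero => exact continuous_const
  | succ n ih => rw [iter_succ]; exact T.continuous_transfer ih

lemma iter_nonneg (n : ℕ) (x : ℝ) : 0 ≤ T.iter n x := by
  induction n generalizing x with
  | zero => exact zero_le_one
  | succ n ih =>
    rw [iter_succ]
    exact Finset.sum_nonneg fun b _ => mul_nonneg (norm_nonneg _) (ih _)

lemma norm_iter_le (n : ℕ) (x : ℝ) : ‖T.iter n x‖ ≤ (T.N : ℝ) ^ n := by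
  induction n generalizing x with
  | zero => simp [iter]
  | succ n ih => rw [iter_succ, pow_succ']; exact T.norm_transfer_le ih x

lemma ruelle_iterate_eq (n : ℕ) (x : T.attractor) :
    (T.ruelle^[n] fun _ => 1) x = T.iter n x := by
  induction n generalizing x with
  | zero => rfl
  | succ n ih =>
    rw [Function.iterate_succ_apply', iter_succ, ruelle, transfer,
      ← Finset.sum_coe_sort T.B fun b => ‖T.mL (T.tau b x)‖ * T.iter n (T.tau b x)]
    simp only [ih]

lemma zero_mem_attractor : (0 : ℝ) ∈ T.attractor :=
  ⟨fun _ => ⟨0, T.zero_mem_B⟩, by simp [encode]⟩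

lemma tau_zero_zero : T.tau 0 0 = 0 := by simp [tau]

lemma tau_sub_tau (b : ℤ) (x y : ℝ) : T.tau b x - T.tau b y = (T.R : ℝ)⁻¹ * (x - y) := by
  unfold tau; ring

lemma norm_mL_zero : ‖T.mL 0‖ = 1 := by
  have hN : (T.N : ℂ) ≠ 0 := by exact_mod_cast T.N_pos.ne'
  have : ∑ l ∈ T.L, expo l 0 = T.N := by simp [expo_zero_right, N, T.card_eq]
  rw [mL, this, inv_mul_cancel₀ hN, norm_one]

lemma exists_lipschitz_mL :
    ∃ K : ℝ, 0 ≤ K ∧ ∀ x y, |‖T.mL x‖ - ‖T.mL y‖| ≤ K * |x - y| := by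
  refine ⟨(T.N : ℝ)⁻¹ * ∑ l ∈ T.L, 2 * Real.pi * |(l : ℝ)|, by positivity, fun x y => ?_⟩
  refine (abs_norm_sub_norm_le _ _).trans ?_
  rw [mL, mL, ← mul_sub, ← Finset.sum_sub_distrib, norm_mul, norm_inv, Complex.norm_natCast,
    mul_assoc, Finset.sum_mul]
  gcongr
  exact (norm_sum_le _ _).trans (Finset.sum_le_sum fun l _ => norm_expo_sub_le _ _ _)

/-! ### Existence of the growth rate. -/

/-- The supremum of `R_L^n 1` over the attractor. -/
noncomputable def supIter (n : ℕ) : ℝ := ⨆ x : T.attractor, (T.ruelle^[n] fun _ => 1) x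

lemma iter_le_supIter (n : ℕ) {x : ℝ} (hx : x ∈ T.attractor) : T.iter n x ≤ T.supIter n := by
  rw [← T.ruelle_iterate_eq n ⟨x, hx⟩]
  exact le_ciSup (T.bddAbove_ruelle n) _

lemma supIter_le {n : ℕ} {M : ℝ} (h : ∀ x ∈ T.attractor, T.iter n x ≤ M) : T.supIter n ≤ M :=
  ciSup_le fun x => by rw [T.ruelle_iterate_eq]; exact h x x.2

lemma transfer_mono {f g : ℝ → ℝ} (h : ∀ x ∈ T.attractor, f x ≤ g x) {x : ℝ}
    (hx : x ∈ T.attractor) : T.transfer f x ≤ T.transfer g x :=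
  Finset.sum_le_sum fun _ hb => mul_le_mul_of_nonneg_left (h _ (T.tau_mem hb hx)) (norm_nonneg _)

lemma transfer_const_mul (c : ℝ) (f : ℝ → ℝ) (x : ℝ) :
    T.transfer (fun y => c * f y) x = c * T.transfer f x := by
  rw [transfer, transfer, Finset.mul_sum]
  exact Finset.sum_congr rfl fun _ _ => by ring

lemma transfer_add (f g : ℝ → ℝ) (x : ℝ) :
    T.transfer (fun y => f y + g y) x = T.transfer f x + T.transfer g x := by
  rw [transfer, transfer, transfer, ← Finset.sum_add_distrib]
  exact Finset.sum_congr rfl fun _ _ => by ring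

lemma transfer_nonneg {f : ℝ → ℝ} (h : ∀ x ∈ T.attractor, 0 ≤ f x) {x : ℝ}
    (hx : x ∈ T.attractor) : 0 ≤ T.transfer f x :=
  Finset.sum_nonneg fun _ hb => mul_nonneg (norm_nonneg _) (h _ (T.tau_mem hb hx))

/-- The branch `τ_0` fixes `0`, where `|m_L| = 1`. This keeps the logarithms in Fekete's lemma
nonnegative and gives `D ≥ 1`. -/
lemma one_le_iter_zero (n : ℕ) : 1 ≤ T.iter n 0 := by
  induction n with
  | zero => exact le_rfl
  | succ n ih =>
    rw [iter_succ]
    refine le_trans ?_ (Finset.single_le_sum (f := fun b : ℤ => ‖T.mL (T.tau b 0)‖ *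
      T.iter n (T.tau b 0)) (fun b _ => mul_nonneg (norm_nonneg _) (T.iter_nonneg _ _))
      T.zero_mem_B)
    simpa only [Int.cast_zero, tau_zero_zero, norm_mL_zero, one_mul] using ih

lemma one_le_supIter (n : ℕ) : 1 ≤ T.supIter n :=
  (T.one_le_iter_zero n).trans (T.iter_le_supIter n T.zero_mem_attractor)

lemma supIter_pos (n : ℕ) : 0 < T.supIter n := one_pos.trans_le (T.one_le_supIter n)

lemma iter_add_le (m n : ℕ) {x : ℝ} (hx : x ∈ T.attractor) :
    T.iter (m + n) x ≤ T.supIter n * T.iter m x := by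
  induction m generalizing x with
  | zero => simpa [iter] using T.iter_le_supIter n hx
  | succ m ih =>
    rw [Nat.add_right_comm, iter_succ, iter_succ, ← transfer_const_mul]
    exact T.transfer_mono (fun y hy => ih hy) hx

lemma supIter_add_le (m n : ℕ) : T.supIter (m + n) ≤ T.supIter m * T.supIter n := by
  refine T.supIter_le fun x hx => (T.iter_add_le m n hx).trans ?_
  rw [mul_comm]
  exact mul_le_mul_of_nonneg_right (T.iter_le_supIter m hx) (T.supIter_pos n).le

/-- The growth rate of `sup R_L^n 1` exists, and it is a lower bound of all the roots. -/
lemma exists_growth_rate : ∃ D : ℝ, 1 ≤ D ∧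
    Tendsto (fun n : ℕ => T.supIter n ^ (1 / (n : ℝ))) atTop (𝓝 D) ∧
    ∀ n : ℕ, D ^ n ≤ T.supIter n := by
  have hsub : Subadditive fun n => Real.log (T.supIter n) := fun m n => by
    rw [← Real.log_mul (T.supIter_pos m).ne' (T.supIter_pos n).ne']
    exact Real.log_le_log (T.supIter_pos _) (T.supIter_add_le m n)
  have hnn : ∀ n : ℕ, 0 ≤ Real.log (T.supIter n) / n := fun n =>
    div_nonneg (Real.log_nonneg (T.one_le_supIter n)) (Nat.cast_nonneg n)
  have hbdd : BddBelow (Set.range fun n : ℕ => Real.log (T.supIter n) / n) :=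
    ⟨0, by rintro _ ⟨n, rfl⟩; exact hnn n⟩
  have hlim := hsub.tendsto_lim hbdd
  refine ⟨Real.exp hsub.lim, Real.one_le_exp (ge_of_tendsto' hlim hnn), ?_, fun n => ?_⟩
  · refine ((Real.continuous_exp.tendsto _).comp hlim).congr fun n => ?_
    rw [Real.rpow_def_of_pos (T.supIter_pos n), Function.comp_apply, mul_one_div]
  · rcases eq_or_ne n 0 with rfl | hn
    · simpa using T.one_le_supIter 0
    · have hn' : (0 : ℝ) < n := by exact_mod_cast hn.bot_lt
      -- Fekete's limit is the infimum of `log (sup R_L^n 1) / n`, hence a lower bound at every `n`.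
      rw [← Real.exp_nat_mul, ← Real.le_log_iff_exp_le (T.supIter_pos n)]
      have := hsub.lim_le_div hbdd hn
      rw [le_div_iff₀ hn'] at this
      linarith

/-- Root test: for `D < r < s`, eventually `sup R_L^n 1 ≤ r^n`. -/
lemma summable_supIter {D s : ℝ} (hs : D < s) (hs0 : 0 < s)
    (hlim : Tendsto (fun n : ℕ => T.supIter n ^ (1 / (n : ℝ))) atTop (𝓝 D)) :
    Summable fun n : ℕ => s⁻¹ ^ n * T.supIter n := by
  obtain ⟨r, hr1, hr2⟩ := exists_between (max_lt hs hs0)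
  have hr0 : 0 < r := (le_max_right _ _).trans_lt hr1
  have hrs : s⁻¹ * r < 1 := by rw [inv_mul_lt_iff₀ hs0, mul_one]; exact hr2
  refine summable_of_isBigO_nat (summable_geometric_of_lt_one (by positivity) hrs)
    (Asymptotics.IsBigO.of_bound 1 ?_)
  filter_upwards [hlim.eventually_lt_const ((le_max_left _ _).trans_lt hr1), eventually_gt_atTop 0]
    with n hn hn0
  have hn0' : (n : ℝ) ≠ 0 := by exact_mod_cast hn0.ne'
  have h : T.supIter n ≤ r ^ n := by
    have := pow_le_pow_left₀ (Real.rpow_nonneg (T.supIter_pos n).le _) hn.le n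
    rwa [← Real.rpow_natCast, ← Real.rpow_mul (T.supIter_pos n).le, one_div_mul_cancel hn0',
      Real.rpow_one] at this
  rw [one_mul, mul_pow, Real.norm_of_nonneg (mul_nonneg (by positivity) (T.supIter_pos n).le),
    Real.norm_of_nonneg (by positivity)]
  gcongr

/-! ### The resolvent equation. -/

/-- The resolvent `∑ s^{-n-1} R_L^n 1`. -/
noncomputable def resolvent (s x : ℝ) : ℝ := ∑' n : ℕ, s⁻¹ ^ (n + 1) * T.iter n x

section Resolvent

variable {s : ℝ}

lemma resolvent_term_nonneg (hs0 : 0 < s) (n : ℕ) (x : ℝ) : 0 ≤ s⁻¹ ^ (n + 1) * T.iter n x :=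
  mul_nonneg (by positivity) (T.iter_nonneg n x)

lemma resolvent_term_le (hs0 : 0 < s) (n : ℕ) {x : ℝ} (hx : x ∈ T.attractor) :
    s⁻¹ ^ (n + 1) * T.iter n x ≤ s⁻¹ ^ (n + 1) * T.supIter n :=
  mul_le_mul_of_nonneg_left (T.iter_le_supIter n hx) (by positivity)

lemma summable_shift (hsum : Summable fun n : ℕ => s⁻¹ ^ n * T.supIter n) :
    Summable fun n : ℕ => s⁻¹ ^ (n + 1) * T.supIter n :=
  (hsum.mul_left s⁻¹).congr fun n => by ring

lemma summable_resolvent (hs0 : 0 < s) (hsum : Summable fun n : ℕ => s⁻¹ ^ n * T.supIter n)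
    {x : ℝ} (hx : x ∈ T.attractor) : Summable fun n : ℕ => s⁻¹ ^ (n + 1) * T.iter n x :=
  Summable.of_nonneg_of_le (fun n => T.resolvent_term_nonneg hs0 n x)
    (fun n => T.resolvent_term_le hs0 n hx) (T.summable_shift hsum)

lemma resolvent_le (hs0 : 0 < s) (hsum : Summable fun n : ℕ => s⁻¹ ^ n * T.supIter n)
    {x : ℝ} (hx : x ∈ T.attractor) :
    T.resolvent s x ≤ ∑' n : ℕ, s⁻¹ ^ (n + 1) * T.supIter n :=
  Summable.tsum_le_tsum (fun n => T.resolvent_term_le hs0 n hx) (T.summable_resolvent hs0 hsum hx)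
    (T.summable_shift hsum)

lemma resolvent_nonneg (hs0 : 0 < s) (x : ℝ) : 0 ≤ T.resolvent s x :=
  tsum_nonneg fun n => T.resolvent_term_nonneg hs0 n x

lemma mul_resolvent (hs0 : 0 < s) (hsum : Summable fun n : ℕ => s⁻¹ ^ n * T.supIter n)
    {x : ℝ} (hx : x ∈ T.attractor) :
    s * T.resolvent s x = 1 + T.transfer (T.resolvent s) x := by
  have h1 : T.transfer (T.resolvent s) x = ∑' n : ℕ, s⁻¹ ^ (n + 1) * T.iter (n + 1) x := by
    simp only [transfer, resolvent, iter_succ, ← tsum_mul_left]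
    rw [← Summable.tsum_finsetSum fun b hb =>
      (T.summable_resolvent hs0 hsum (T.tau_mem hb hx)).mul_left _]
    refine tsum_congr fun n => ?_
    rw [Finset.mul_sum]
    exact Finset.sum_congr rfl fun _ _ => by ring
  have h2 : T.iter 0 x = 1 := rfl
  rw [h1, resolvent, (T.summable_resolvent hs0 hsum hx).tsum_eq_zero_add, mul_add, ← tsum_mul_left,
    h2]
  congr 1
  · simp [hs0.ne']
  · refine tsum_congr fun n => ?_
    rw [pow_succ' s⁻¹ (n + 1)]
    field_simp

end Resolvent

/-- Finite form of the resolvent equation; it closes the induction in the oscillation estimate. -/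
lemma sum_range_succ_iter (q : ℝ) (n : ℕ) (x : ℝ) :
    ∑ j ∈ Finset.range (n + 1), q ^ (j + 1) * T.iter j x =
      q + q * T.transfer (fun y => ∑ j ∈ Finset.range n, q ^ (j + 1) * T.iter j y) x := by
  have h0 : T.iter 0 x = 1 := rfl
  have h : T.transfer (fun y => ∑ j ∈ Finset.range n, q ^ (j + 1) * T.iter j y) x =
      ∑ j ∈ Finset.range n, q ^ (j + 1) * T.iter (j + 1) x := by
    simp only [transfer, iter_succ, Finset.mul_sum]
    rw [Finset.sum_comm]
    exact Finset.sum_congr rfl fun _ _ => Finset.sum_congr rfl fun _ _ => by ring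
  rw [Finset.sum_range_succ', h, h0, Finset.mul_sum, add_comm]
  congr 1
  · ring
  · exact Finset.sum_congr rfl fun _ _ => by ring

/-! ### Lasota-Yorke estimate, blow-up, and a uniform ball where the iterates are large. -/

variable {s H : ℝ} {h : ℝ → ℝ}

/-- Oscillation of a solution of `s h = 1 + R_L h` (a Lasota-Yorke inequality). -/
lemma abs_sub_le_of_mul_eq {K : ℝ} (hK : ∀ x y, |‖T.mL x‖ - ‖T.mL y‖| ≤ K * |x - y|)
    (hs0 : 0 < s) (h0 : ∀ x ∈ T.attractor, 0 ≤ h x) (hH : ∀ x ∈ T.attractor, h x ≤ H)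
    (heq : ∀ x ∈ T.attractor, s * h x = 1 + T.transfer h x) (n : ℕ) {x y : ℝ}
    (hx : x ∈ T.attractor) (hy : y ∈ T.attractor) :
    |h x - h y| ≤ T.N * K * H * |x - y| *
      (∑ j ∈ Finset.range n, ((T.R : ℝ)⁻¹ * s⁻¹) ^ (j + 1) * T.iter j x) +
        s⁻¹ ^ n * H * T.iter n x := by
  induction n generalizing x y with
  | zero =>
    simp only [Finset.range_zero, Finset.sum_empty, mul_zero, zero_add, pow_zero, one_mul]
    change _ ≤ H * 1
    rw [abs_le]
    constructor <;> linarith [h0 x hx, h0 y hy, hH x hx, hH y hy]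
  | succ n ih =>
    set q : ℝ := (T.R : ℝ)⁻¹ * s⁻¹ with hq
    set S : ℝ → ℝ := fun z => ∑ j ∈ Finset.range n, q ^ (j + 1) * T.iter j z with hS
    set c : ℝ := T.N * K * H * |x - y| with hc
    -- Each branch contributes the oscillation of `h` at points brought closer by the factor `1/R`,
    -- plus the variation of the weight `|m_L|`, bounded through its Lipschitz constant `K`.
    have hstep : ∀ b ∈ T.B, |‖T.mL (T.tau b x)‖ * h (T.tau b x) -
        ‖T.mL (T.tau b y)‖ * h (T.tau b y)| ≤
        ‖T.mL (T.tau b x)‖ * (((T.R : ℝ)⁻¹ * c) * S (T.tau b x) +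
          (s⁻¹ ^ n * H) * T.iter n (T.tau b x)) + K * ((T.R : ℝ)⁻¹ * |x - y|) * H := fun b hb => by
      have hbx := T.tau_mem hb hx
      have hby := T.tau_mem hb hy
      have hd : |T.tau b x - T.tau b y| = (T.R : ℝ)⁻¹ * |x - y| := by
        rw [tau_sub_tau, abs_mul, abs_of_nonneg T.inv_R_nonneg]
      have h1 := ih hbx hby
      rw [hd] at h1
      have h2 := hK (T.tau b x) (T.tau b y)
      rw [hd] at h2
      have hsplit : ‖T.mL (T.tau b x)‖ * h (T.tau b x) - ‖T.mL (T.tau b y)‖ * h (T.tau b y) =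
          ‖T.mL (T.tau b x)‖ * (h (T.tau b x) - h (T.tau b y)) +
            (‖T.mL (T.tau b x)‖ - ‖T.mL (T.tau b y)‖) * h (T.tau b y) := by ring
      rw [hsplit]
      refine (abs_add_le _ _).trans (add_le_add ?_ ?_)
      · rw [abs_mul, abs_norm]
        refine mul_le_mul_of_nonneg_left (h1.trans (le_of_eq ?_)) (norm_nonneg _)
        rw [hc, hS]; ring
      · rw [abs_mul, abs_of_nonneg (h0 _ hby)]
        exact mul_le_mul h2 (hH _ hby) (h0 _ hby) ((abs_nonneg _).trans h2)
    have hsum : s * |h x - h y| ≤ (T.R : ℝ)⁻¹ * c * T.transfer S x +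
        s⁻¹ ^ n * H * T.iter (n + 1) x + (T.R : ℝ)⁻¹ * c := by
      have e1 : s * |h x - h y| = |T.transfer h x - T.transfer h y| := by
        rw [show s * |h x - h y| = |s * (h x - h y)| by rw [abs_mul, abs_of_pos hs0], mul_sub, heq x hx, heq y hy]
        congr 1; ring
      rw [e1, iter_succ, ← transfer_const_mul, ← transfer_const_mul, ← transfer_add, transfer,
        transfer, ← Finset.sum_sub_distrib]
      refine (Finset.abs_sum_le_sum_abs _ _).trans ((Finset.sum_le_sum hstep).trans (le_of_eq ?_))
      rw [Finset.sum_add_distrib, Finset.sum_const, nsmul_eq_mul, transfer, hc, N]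
      congr 1
      ring
    rw [sum_range_succ_iter]
    change _ ≤ c * (q + q * T.transfer S x) + _
    rw [← le_div_iff₀' hs0] at hsum
    refine hsum.trans (le_of_eq ?_)
    rw [hq, pow_succ]
    field_simp
    ring

/-- A solution of `s h = 1 + R_L h` is small where all `R_L^n 1` are small. -/
lemma exists_pow_mul_le (S : ℝ) (n : ℕ) : ∃ A : ℝ, 0 ≤ A ∧ ∀ (s H : ℝ) (h : ℝ → ℝ), 0 < s → s ≤ S →
    (∀ x ∈ T.attractor, h x ≤ H) → (∀ x ∈ T.attractor, s * h x = 1 + T.transfer h x) →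
    ∀ x ∈ T.attractor, s ^ n * h x ≤ H * T.iter n x + A := by
  induction n with
  | zero => exact ⟨0, le_rfl, fun s H h _ _ hH _ x hx => by simpa [iter] using hH x hx⟩
  | succ n ih =>
    obtain ⟨A, hA0, hA⟩ := ih
    -- One more use of the equation adds `s^n ≤ |S|^n` and replaces `A` by `A R_L 1`. The constant
    -- depends only on `S` and `n`, never on `s`, `H` or `h`.
    refine ⟨|S| ^ n + A * T.supIter 1,
      add_nonneg (by positivity) (mul_nonneg hA0 (T.supIter_pos 1).le), ?_⟩
    intro s H h hs0 hsS hH heq x hx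
    have h1 : s ^ (n + 1) * h x = s ^ n + s ^ n * T.transfer h x := by
      rw [pow_succ, mul_assoc, heq x hx]; ring
    have h2 : T.transfer (fun y => s ^ n * h y) x ≤
        T.transfer (fun y => H * T.iter n y + A * 1) x :=
      T.transfer_mono (fun y hy => by simpa using hA s H h hs0 hsS hH heq y hy) hx
    rw [transfer_add, transfer_const_mul, transfer_const_mul, ← iter_succ,
      T.transfer_const_mul A fun _ => 1] at h2
    have h3 : A * T.transfer (fun _ => 1) x ≤ A * T.supIter 1 :=
      mul_le_mul_of_nonneg_left (T.iter_le_supIter 1 hx) hA0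
    have h4 : s ^ n ≤ |S| ^ n := pow_le_pow_left₀ hs0.le (hsS.trans (le_abs_self _)) n
    linarith

variable {D : ℝ}

/-- The resolvent blows up at the growth rate. -/
lemma inv_sub_le_of_mul_eq (hD : 1 ≤ D) (hpow : ∀ n : ℕ, D ^ n ≤ T.supIter n) (hs : D < s)
    (h0 : ∀ x ∈ T.attractor, 0 ≤ h x) (hH : ∀ x ∈ T.attractor, h x ≤ H)
    (heq : ∀ x ∈ T.attractor, s * h x = 1 + T.transfer h x) : 1 ≤ H * (s - D) := by
  have hs0 : 0 < s := by linarith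
  have hlow : ∀ x ∈ T.attractor, 1 ≤ s * h x := fun x hx => by
    rw [heq x hx]; linarith [T.transfer_nonneg h0 hx]
  have hH0 : 0 < H := by
    have h1 := hlow 0 T.zero_mem_attractor
    have h2 : 0 < h 0 := pos_of_mul_pos_right (one_pos.trans_le h1) hs0.le
    exact h2.trans_le (hH 0 T.zero_mem_attractor)
  -- Since `1 ≥ h / H`, the equation gives `R_L h ≤ (s - 1/H) h`. Comparison with `1 ≤ s h` then
  -- limits the growth of `R_L^n 1` to `t^n`, so `D ≤ t`.
  set t : ℝ := s - H⁻¹ with ht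
  have hQ : ∀ x ∈ T.attractor, T.transfer h x ≤ t * h x := fun x hx => by
    have h1 : H⁻¹ * h x ≤ 1 := by rw [inv_mul_le_iff₀ hH0, mul_one]; exact hH x hx
    have := heq x hx
    rw [ht, sub_mul]; linarith
  have ht0 : 0 ≤ t := by
    have h1 := (T.transfer_nonneg h0 T.zero_mem_attractor).trans (hQ 0 T.zero_mem_attractor)
    have h2 : 0 < h 0 :=
      pos_of_mul_pos_right (one_pos.trans_le (hlow 0 T.zero_mem_attractor)) hs0.le
    exact nonneg_of_mul_nonneg_left h1 h2
  have hiter : ∀ n : ℕ, ∀ x ∈ T.attractor, T.iter n x ≤ s * t ^ n * h x := fun n => by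
    induction n with
    | zero => intro x hx; simpa [iter] using hlow x hx
    | succ n ih =>
      intro x hx
      rw [iter_succ]
      refine (T.transfer_mono ih hx).trans ?_
      rw [transfer_const_mul, pow_succ, ← mul_assoc, mul_assoc (s * t ^ n)]
      exact mul_le_mul_of_nonneg_left (hQ x hx) (by positivity)
  have hle : ∀ n : ℕ, D ^ n ≤ s * H * t ^ n := fun n => by
    refine (hpow n).trans (T.supIter_le fun x hx => (hiter n x hx).trans ?_)
    have := mul_le_mul_of_nonneg_left (hH x hx) (by positivity : 0 ≤ s * t ^ n)
    linarith
  have hDt : D ≤ t := by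
    by_contra hlt
    push Not at hlt
    have hlim := (tendsto_pow_atTop_nhds_zero_of_lt_one (r := t / D) (by positivity)
      (by rw [div_lt_one (by linarith)]; exact hlt)).const_mul (s * H)
    rw [mul_zero] at hlim
    have : (1 : ℝ) ≤ 0 := ge_of_tendsto' hlim fun n => by
      rw [div_pow, ← mul_div_assoc, one_le_div (by positivity)]
      exact hle n
    linarith
  have : H⁻¹ ≤ s - D := by rw [ht] at hDt; linarith
  rwa [inv_le_iff_one_le_mul₀' hH0] at this

/-- `R_L^n 1` is of the order `D^n` on the trace of a ball whose radius does not depend on `n`. -/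
lemma exists_ball_le_iter (hD : 1 ≤ D)
    (hlim : Tendsto (fun n : ℕ => T.supIter n ^ (1 / (n : ℝ))) atTop (𝓝 D))
    (hpow : ∀ n : ℕ, D ^ n ≤ T.supIter n) :
    ∃ r : ℝ, 0 < r ∧ ∀ n : ℕ, ∃ x ∈ T.attractor, ∀ y ∈ T.attractor, |x - y| ≤ r →
      D ^ n / 4 ≤ T.iter n y := by
  have hD0 : 0 < D := by linarith
  have hR := T.R_pos
  obtain ⟨K, hK0, hK⟩ := T.exists_lipschitz_mL
  -- The contraction improves the ratio from `1/D` to `1/(R D)`, so the series converges even at `s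
  -- = D`; this is why `M` can be independent of `s`.
  have hsumRD : Summable fun j : ℕ => ((T.R : ℝ)⁻¹ * D⁻¹) ^ (j + 1) * T.supIter j := by
    have := T.summable_shift (T.summable_supIter (s := T.R * D)
      (by nlinarith [T.one_lt_R']) (by positivity) hlim)
    simpa only [mul_inv] using this
  set M : ℝ := T.N * K * ∑' j : ℕ, ((T.R : ℝ)⁻¹ * D⁻¹) ^ (j + 1) * T.supIter j with hM
  have hM0 : 0 ≤ M := mul_nonneg (by positivity)
    (tsum_nonneg fun j => mul_nonneg (by positivity) (T.supIter_pos j).le)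
  -- With Lipschitz constant `M H`, the function `h` varies by at most `H / 4` over this radius.
  refine ⟨1 / (4 * (M + 1)), by positivity, fun n => ?_⟩
  -- `A` is fixed before `s`, so `δ = s - D` can be chosen small in terms of `A`. Blow-up `1 ≤ H δ`
  -- then makes `A` negligible against `H D^n`.
  obtain ⟨A, hA0, hA⟩ := T.exists_pow_mul_le (D + 1) n
  obtain ⟨δ, hδ0, hδ1, hδA⟩ : ∃ δ : ℝ, 0 < δ ∧ δ ≤ 1 ∧ A * δ ≤ D ^ n / 4 := by
    refine ⟨min 1 (D ^ n / (4 * (A + 1))), by positivity, min_le_left _ _, ?_⟩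
    calc A * min 1 (D ^ n / (4 * (A + 1))) ≤ (A + 1) * (D ^ n / (4 * (A + 1))) :=
          mul_le_mul (by linarith) (min_le_right _ _) (by positivity) (by positivity)
      _ = D ^ n / 4 := by field_simp
  set s : ℝ := D + δ with hs
  have hDs : D < s := by linarith
  have hs0 : 0 < s := by linarith
  have hsum := T.summable_supIter hDs hs0 hlim
  set h : ℝ → ℝ := T.resolvent s with hh
  have heq : ∀ x ∈ T.attractor, s * h x = 1 + T.transfer h x :=
    fun x hx => T.mul_resolvent hs0 hsum hx
  have h0 : ∀ x ∈ T.attractor, 0 ≤ h x := fun x _ => T.resolvent_nonneg hs0 x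
  have hbdd : BddAbove (Set.range fun x : T.attractor => h x) :=
    ⟨_, by rintro _ ⟨x, rfl⟩; exact T.resolvent_le hs0 hsum x.2⟩
  set H : ℝ := ⨆ x : T.attractor, h x with hHdef
  have hH : ∀ x ∈ T.attractor, h x ≤ H := fun x hx => le_ciSup hbdd (⟨x, hx⟩ : T.attractor)
  have hblow : 1 ≤ H * δ := by
    have := T.inv_sub_le_of_mul_eq hD hpow hDs h0 hH heq
    rwa [hs, add_sub_cancel_left] at this
  have hHpos : 0 < H := pos_of_mul_pos_left (one_pos.trans_le hblow) hδ0.le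
  have hLip : ∀ x ∈ T.attractor, ∀ y ∈ T.attractor, |h x - h y| ≤ M * H * |x - y| := by
    intro x hx y hy
    have hb : ∀ m : ℕ, |h x - h y| ≤ M * H * |x - y| + H * (s⁻¹ ^ m * T.supIter m) := fun m => by
      refine (T.abs_sub_le_of_mul_eq hK hs0 h0 hH heq m hx hy).trans (add_le_add ?_ ?_)
      · have hle : ∑ j ∈ Finset.range m, ((T.R : ℝ)⁻¹ * s⁻¹) ^ (j + 1) * T.iter j x ≤
            ∑' j : ℕ, ((T.R : ℝ)⁻¹ * D⁻¹) ^ (j + 1) * T.supIter j := by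
          refine le_trans (Finset.sum_le_sum fun j _ => ?_) (hsumRD.sum_le_tsum (Finset.range m)
            fun j _ => mul_nonneg (by positivity) (T.supIter_pos j).le)
          refine mul_le_mul ?_ (T.iter_le_supIter j hx) (T.iter_nonneg _ _) (by positivity)
          gcongr
        have := mul_le_mul_of_nonneg_left hle
          (by positivity : 0 ≤ T.N * K * H * |x - y|)
        rw [hM]; linarith
      · have := mul_le_mul_of_nonneg_left (T.iter_le_supIter m hx)
          (by positivity : 0 ≤ s⁻¹ ^ m * H)
        linarith
    have hl := (hsum.tendsto_atTop_zero.const_mul H).const_add (M * H * |x - y|)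
    rw [mul_zero, add_zero] at hl
    exact ge_of_tendsto' hl hb
  -- A near-maximum suffices: `3/4 H` minus the variation `H / 4` leaves `H / 2` on the whole ball.
  obtain ⟨x, hx⟩ := exists_lt_of_lt_ciSup (show 3 / 4 * H < ⨆ x : T.attractor, h x by
    rw [← hHdef]; linarith)
  refine ⟨x, x.2, fun y hy hxy => ?_⟩
  have h1 : M * H * |↑x - y| ≤ H / 4 := by
    calc M * H * |↑x - y| ≤ (M + 1) * H * (1 / (4 * (M + 1))) := by gcongr; linarith
      _ = H / 4 := by field_simp
  have h2 : H / 2 ≤ h y := by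
    have := le_abs_self (h x - h y)
    linarith [hLip x x.2 y hy]
  have h3 := hA s H h hs0 (by linarith) hH heq y hy
  -- Now `D^n H / 2 ≤ s^n h ≤ H R_L^n 1 + A` and `A ≤ A H δ ≤ H D^n / 4`; dividing by `H` leaves
  -- `D^n / 4`.
  have h4 : D ^ n * (H / 2) ≤ s ^ n * h y := by gcongr
  have h5 : A ≤ H * (D ^ n / 4) := by
    have := mul_le_mul_of_nonneg_left hblow hA0
    have := mul_le_mul_of_nonneg_left hδA hHpos.le
    linarith
  have h6 : H * (D ^ n / 4) ≤ H * T.iter n y := by linarith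
  exact le_of_mul_le_mul_left h6 hHpos

/-! ### Support of the measure and lower bounds for the mass of `|D_0|`. -/

lemma ae_mem_attractor : ∀ᵐ x ∂T.mu, x ∈ T.attractor := by
  exact (ae_map_iff T.continuous_encode.measurable.aemeasurable
    T.isCompact_attractor.isClosed.measurableSet).2 (Eventually.of_forall fun w => ⟨w, rfl⟩)

lemma exists_tau_eq {x : ℝ} (hx : x ∈ T.attractor) :
    ∃ b ∈ T.B, ∃ y ∈ T.attractor, T.tau b y = x := by
  rw [attractor_eq] at hx
  simpa only [Set.mem_iUnion, Set.mem_image, exists_prop] using hx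

lemma exists_dist_lt : ∃ d : ℝ, 0 < d ∧ ∀ x ∈ T.attractor, ∀ y ∈ T.attractor, |x - y| < d := by
  obtain ⟨d, hd⟩ := Metric.isBounded_iff.1 T.isCompact_attractor.isBounded
  have hd0 : 0 ≤ d := by simpa using hd T.zero_mem_attractor T.zero_mem_attractor
  exact ⟨d + 1, by linarith, fun x hx y hy =>
    (show |x - y| ≤ d from hd hx hy).trans_lt (lt_add_one d)⟩

lemma exists_inv_pow_mul_lt (d : ℝ) {r : ℝ} (hr : 0 < r) : ∃ n : ℕ, (T.R : ℝ)⁻¹ ^ n * d < r := by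
  have h := (tendsto_pow_atTop_nhds_zero_of_lt_one T.inv_R_nonneg T.inv_R_lt_one).mul_const d
  rw [zero_mul] at h
  exact (h.eventually_lt_const hr).exists

lemma abs_tau_sub_tau (b : ℤ) (x y : ℝ) :
    |T.tau b x - T.tau b y| = (T.R : ℝ)⁻¹ * |x - y| := by
  rw [tau_sub_tau, abs_mul, abs_of_nonneg T.inv_R_nonneg]

/-- Every ball centered on the attractor has positive measure. -/
lemma mu_ball_pos {x r : ℝ} (hx : x ∈ T.attractor) (hr : 0 < r) : 0 < T.mu (Metric.ball x r) := by
  obtain ⟨d, hd0, hd⟩ := T.exists_dist_lt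
  -- A ball of radius `d` contains all of `X_B`. Writing `x = τ_b y` and pulling back by `τ_b`
  -- enlarges the radius by `R`, and invariance bounds the measure below by `1/N` times that of the
  -- larger ball.
  have key : ∀ n : ℕ, ∀ x ∈ T.attractor, 0 < T.mu (Metric.ball x ((T.R : ℝ)⁻¹ ^ n * d)) := by
    intro n
    induction n with
    | zero =>
      intro x hx
      have : T.mu (Metric.ball x ((T.R : ℝ)⁻¹ ^ 0 * d)) = 1 := by
        rw [prob_compl_eq_zero_iff measurableSet_ball |>.symm]
        refine measure_mono_null ?_ (mem_ae_iff.1 T.ae_mem_attractor)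
        intro y hy hyX
        refine hy ?_
        rw [Metric.mem_ball, pow_zero, one_mul]
        exact hd y hyX x hx
      rw [this]; exact one_pos
    | succ n ih =>
      intro x hx
      obtain ⟨b, hb, y, hy, rfl⟩ := T.exists_tau_eq hx
      have hpre : T.tau b ⁻¹' Metric.ball (T.tau b y) ((T.R : ℝ)⁻¹ ^ (n + 1) * d) =
          Metric.ball y ((T.R : ℝ)⁻¹ ^ n * d) := by
        ext z
        rw [Set.mem_preimage, Metric.mem_ball, Metric.mem_ball, Real.dist_eq, Real.dist_eq,
          abs_tau_sub_tau, pow_succ', mul_assoc, mul_lt_mul_iff_right₀ (inv_pos.2 T.R_pos)]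
      rw [T.mu_invariant measurableSet_ball]
      refine ENNReal.mul_pos (by simp) (ne_of_gt ?_)
      refine (ih y hy).trans_le ?_
      rw [← hpre]
      exact Finset.single_le_sum (f := fun b => T.mu (T.tau b ⁻¹' Metric.ball _ _))
        (fun _ _ => zero_le) hb
  obtain ⟨n, hn⟩ := T.exists_inv_pow_mul_lt d hr
  exact (key n x hx).trans_le (measure_mono (Metric.ball_subset_ball hn.le))

/-- The attractor is perfect if there are at least two digits. -/
lemma exists_ne_mem_attractor (hN : 1 < T.N) {x r : ℝ} (hx : x ∈ T.attractor) (hr : 0 < r) :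
    ∃ y ∈ T.attractor, y ≠ x ∧ |y - x| < r := by
  obtain ⟨d, hd0, hd⟩ := T.exists_dist_lt
  -- At scale `d` one of the distinct points `0` and `τ_b 0 = b / R` differs from `x`; the branches
  -- carry this to smaller scales.
  have key : ∀ n : ℕ, ∀ x ∈ T.attractor, ∃ y ∈ T.attractor, y ≠ x ∧
      |y - x| < (T.R : ℝ)⁻¹ ^ n * d := by
    intro n
    induction n with
    | zero =>
      intro x hx
      obtain ⟨b, hb, hb0⟩ := Finset.exists_mem_ne hN 0
      have hne : T.tau b 0 ≠ 0 := by
        rw [tau, zero_add]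
        exact mul_ne_zero (inv_ne_zero T.R_pos.ne') (by exact_mod_cast hb0)
      have hmem := T.tau_mem hb T.zero_mem_attractor
      by_cases h : x = 0
      · exact ⟨_, hmem, h ▸ hne, by simpa using hd _ hmem _ hx⟩
      · exact ⟨0, T.zero_mem_attractor, Ne.symm h, by
          simpa only [pow_zero, one_mul] using hd _ T.zero_mem_attractor _ hx⟩
    | succ n ih =>
      intro x hx
      obtain ⟨b, hb, z, hz, rfl⟩ := T.exists_tau_eq hx
      obtain ⟨y, hy, hyz, hlt⟩ := ih z hz
      refine ⟨T.tau b y, T.tau_mem hb hy, fun h => hyz ?_, ?_⟩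
      · have h0 := T.tau_sub_tau b y z
        rw [h, sub_self] at h0
        exact sub_eq_zero.1 ((mul_eq_zero.1 h0.symm).resolve_left (inv_ne_zero T.R_pos.ne'))
      · rw [abs_tau_sub_tau, pow_succ', mul_assoc]
        exact mul_lt_mul_of_pos_left hlt (inv_pos.2 T.R_pos)
  obtain ⟨n, hn⟩ := T.exists_inv_pow_mul_lt d hr
  obtain ⟨y, hy, hne, hlt⟩ := key n x hx
  exact ⟨y, hy, hne, hlt.trans hn⟩

/-- Otherwise `D_0` would vanish at points accumulating at `x`, hence identically by analyticity,
contradicting `D_0(0) = #Λ_0 ≠ 0`. -/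
lemma exists_dirichletKernel_ne (hN : 1 < T.N) {x r : ℝ} (hx : x ∈ T.attractor) (hr : 0 < r) :
    ∃ y ∈ T.attractor, |y - x| < r ∧ T.dirichletKernel 0 y ≠ 0 := by
  by_contra! hzero
  have hfreq : ∃ᶠ z in 𝓝[≠] x, T.dirichletKernel 0 z = (fun _ => (0 : ℂ)) z := by
    rw [(nhdsWithin_hasBasis Metric.nhds_basis_ball _).frequently_iff]
    intro ε hε
    obtain ⟨y, hy, hne, hlt⟩ := T.exists_ne_mem_attractor hN hx (lt_min hε hr)
    exact ⟨y, ⟨hlt.trans_le (min_le_left _ _), hne⟩, hzero y hy (hlt.trans_le (min_le_right _ _))⟩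
  have := AnalyticOnNhd.eq_of_frequently_eq (fun z _ => T.analyticAt_dirichletKernel 0 z)
    (fun _ _ => analyticAt_const) hfreq
  exact T.dirichletKernel_zero_zero_ne (congrFun this 0)

lemma integrable_dirichletKernel (n : ℕ) : Integrable (fun x => ‖T.dirichletKernel n x‖) T.mu :=
  Integrable.of_bound (by fun_prop) _
    (Eventually.of_forall fun x => by rw [norm_norm]; exact T.norm_dirichletKernel_le n x)

lemma setIntegral_dirichletKernel_pos (hN : 1 < T.N) {x r : ℝ} (hx : x ∈ T.attractor)
    (hr : 0 < r) : 0 < ∫ y in Metric.ball x r, ‖T.dirichletKernel 0 y‖ ∂T.mu := by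
  obtain ⟨y, hy, hyx, hne⟩ := T.exists_dirichletKernel_ne hN hx hr
  rw [setIntegral_pos_iff_support_of_nonneg_ae (Eventually.of_forall fun _ => norm_nonneg _)
    (T.integrable_dirichletKernel 0).integrableOn]
  have hopen : IsOpen (Function.support (fun y => ‖T.dirichletKernel 0 y‖) ∩ Metric.ball x r) :=
    (T.continuous_dirichletKernel 0).norm.isOpen_support.inter Metric.isOpen_ball
  obtain ⟨ε, hε, hsub⟩ := Metric.isOpen_iff.1 hopen y ⟨by simpa using hne, hyx⟩
  exact (T.mu_ball_pos hy hε).trans_le (measure_mono hsub)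

/-- The centres found for `R_L^n 1` move with `n`, so a bound uniform in `x` is needed. For `z`
within `r/2` of `x`, the `r`-ball at `z` contains the `r/2`-ball at `x`, and compactness concludes.
-/
lemma exists_le_setIntegral_dirichletKernel (hN : 1 < T.N) {r : ℝ} (hr : 0 < r) :
    ∃ c : ℝ, 0 < c ∧ ∀ x ∈ T.attractor,
      c ≤ ∫ y in Metric.ball x r, ‖T.dirichletKernel 0 y‖ ∂T.mu := by
  refine T.isCompact_attractor.induction_on (p := fun s => ∃ c : ℝ, 0 < c ∧ ∀ x ∈ s,
    c ≤ ∫ y in Metric.ball x r, ‖T.dirichletKernel 0 y‖ ∂T.mu) ⟨1, one_pos, by simp⟩ ?_ ?_ ?_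
  · rintro s t hst ⟨c, hc, h⟩
    exact ⟨c, hc, fun x hx => h x (hst hx)⟩
  · rintro s t ⟨c, hc, h⟩ ⟨c', hc', h'⟩
    refine ⟨min c c', lt_min hc hc', ?_⟩
    rintro x (hx | hx)
    · exact (min_le_left _ _).trans (h x hx)
    · exact (min_le_right _ _).trans (h' x hx)
  · intro x hx
    refine ⟨Metric.ball x (r / 2), mem_nhdsWithin_of_mem_nhds (Metric.ball_mem_nhds x (half_pos hr)),
      _, T.setIntegral_dirichletKernel_pos hN hx (half_pos hr), fun z hz => ?_⟩
    refine setIntegral_mono_set (T.integrable_dirichletKernel 0).integrableOn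
      (Eventually.of_forall fun _ => norm_nonneg _) (LE.le.eventuallyLE ?_)
    refine Metric.ball_subset_ball' ?_
    rw [Metric.mem_ball, dist_comm] at hz
    linarith

/-! ### Two-sided bounds for `‖D_n‖_1`. -/

lemma exists_mul_pow_le_dirichletNorm {D : ℝ} (hD : 1 < D)
    (hlim : Tendsto (fun n : ℕ => T.supIter n ^ (1 / (n : ℝ))) atTop (𝓝 D))
    (hpow : ∀ n : ℕ, D ^ n ≤ T.supIter n) :
    ∃ C : ℝ, 0 < C ∧ ∀ n : ℕ, C * D ^ n ≤ T.dirichletNorm n := by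
  -- `1 < D ≤ sup R_L 1 ≤ N`, which excludes the one-point attractor.
  have hN : 1 < T.N := by
    have h1 := (hpow 1).trans (T.supIter_le fun x _ => (le_abs_self _).trans (T.norm_iter_le 1 x))
    rw [pow_one, pow_one] at h1
    exact_mod_cast hD.trans_le h1
  obtain ⟨r, hr, hball⟩ := T.exists_ball_le_iter hD.le hlim hpow
  obtain ⟨c, hc, hint⟩ := T.exists_le_setIntegral_dirichletKernel hN hr
  refine ⟨c / 4, by positivity, fun n => ?_⟩
  obtain ⟨x, hx, hle⟩ := hball n
  have hi : Integrable (fun y => ‖T.dirichletKernel 0 y‖ * T.iter n y) T.mu :=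
    (T.integrable_dirichletKernel 0).mul_bdd (c := (T.N : ℝ) ^ n)
      (T.continuous_iter n).aestronglyMeasurable (Eventually.of_forall (T.norm_iter_le n))
  rw [dirichletNorm_eq]
  calc c / 4 * D ^ n = c * (D ^ n / 4) := by ring
    _ ≤ (∫ y in Metric.ball x r, ‖T.dirichletKernel 0 y‖ ∂T.mu) * (D ^ n / 4) := by
      gcongr; exact hint x hx
    _ = ∫ y in Metric.ball x r, ‖T.dirichletKernel 0 y‖ * (D ^ n / 4) ∂T.mu :=
      (integral_mul_const _ _).symm
    _ ≤ ∫ y in Metric.ball x r, ‖T.dirichletKernel 0 y‖ * T.iter n y ∂T.mu := by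
      refine setIntegral_mono_on_ae ((T.integrable_dirichletKernel 0).mul_const _).integrableOn
        hi.integrableOn measurableSet_ball ?_
      filter_upwards [T.ae_mem_attractor] with y hy hyx
      refine mul_le_mul_of_nonneg_left (hle y hy ?_) (norm_nonneg _)
      rw [Metric.mem_ball, dist_comm] at hyx
      exact hyx.le
    _ ≤ ∫ y, ‖T.dirichletKernel 0 y‖ * T.iter n y ∂T.mu :=
      setIntegral_le_integral hi
        (Eventually.of_forall fun y => mul_nonneg (norm_nonneg _) (T.iter_nonneg n y))

lemma dirichletNorm_le (n : ℕ) :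
    T.dirichletNorm n ≤ (T.finite_freq 0).toFinset.card * T.supIter n := by
  rw [dirichletNorm_eq]
  refine (le_abs_self _).trans ?_
  have h := norm_integral_le_of_norm_le_const (μ := T.mu)
    (f := fun y => ‖T.dirichletKernel 0 y‖ * T.iter n y)
    (C := (T.finite_freq 0).toFinset.card * T.supIter n) ?_
  · simpa using h
  · filter_upwards [T.ae_mem_attractor] with y hy
    rw [norm_mul, norm_norm, Real.norm_of_nonneg (T.iter_nonneg n y)]
    exact mul_le_mul (T.norm_dirichletKernel_le 0 y) (T.iter_le_supIter n hy) (T.iter_nonneg n y)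
      (Nat.cast_nonneg _)

/-! ### Unbounded partial sums at `0`. -/

section BanachSteinhaus

open scoped BoundedContinuousFunction

lemma partialSum_zero (n : ℕ) (f : ℝ →ᵇ ℂ) :
    T.partialSum f n 0 = ∫ y, f y * (starRingEnd ℂ) (T.dirichletKernel n y) ∂T.mu := by
  simp only [partialSum, expo_zero_right, mul_one]
  rw [← integral_finsetSum]
  · congr 1
    funext y
    rw [dirichletKernel, map_sum, Finset.mul_sum]
    exact Finset.sum_congr rfl fun a _ => by rw [expo_neg_left]
  · intro a _
    refine Integrable.of_bound (by fun_prop) ‖f‖ (Eventually.of_forall fun y => ?_)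
    rw [norm_mul, norm_expo, mul_one]
    exact f.norm_coe_le_norm y

lemma norm_mul_conj_dirichletKernel_le (n : ℕ) (f : ℝ →ᵇ ℂ) (y : ℝ) :
    ‖f y * (starRingEnd ℂ) (T.dirichletKernel n y)‖ ≤ (T.finite_freq n).toFinset.card * ‖f‖ := by
  rw [norm_mul, RCLike.norm_conj, mul_comm]
  exact mul_le_mul (T.norm_dirichletKernel_le n y) (f.norm_coe_le_norm y) (norm_nonneg _)
    (Nat.cast_nonneg _)

lemma integrable_mul_conj_dirichletKernel (n : ℕ) (f : ℝ →ᵇ ℂ) :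
    Integrable (fun y => f y * (starRingEnd ℂ) (T.dirichletKernel n y)) T.mu :=
  Integrable.of_bound (f.continuous.mul
    (Complex.continuous_conj.comp (T.continuous_dirichletKernel n))).aestronglyMeasurable _
    (Eventually.of_forall (T.norm_mul_conj_dirichletKernel_le n f))

/-- The functional `f ↦ s_n(f; 0)` on bounded continuous functions. -/
noncomputable def partialSumCLM (n : ℕ) : (ℝ →ᵇ ℂ) →L[ℂ] ℂ :=
  LinearMap.mkContinuous
    { toFun := fun f => T.partialSum f n 0
      map_add' := fun f g => by
        simp only [partialSum_zero, BoundedContinuousFunction.add_apply, add_mul]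
        exact integral_add (T.integrable_mul_conj_dirichletKernel n f)
          (T.integrable_mul_conj_dirichletKernel n g)
      map_smul' := fun c f => by
        simp only [partialSum_zero, BoundedContinuousFunction.smul_apply, smul_eq_mul, mul_assoc,
          RingHom.id_apply]
        exact integral_const_mul _ _ }
    (T.finite_freq n).toFinset.card fun f => by
      change ‖T.partialSum f n 0‖ ≤ _
      rw [partialSum_zero]
      simpa using norm_integral_le_of_norm_le_const (μ := T.mu)
        (Eventually.of_forall (T.norm_mul_conj_dirichletKernel_le n f))

lemma partialSumCLM_apply (n : ℕ) (f : ℝ →ᵇ ℂ) : T.partialSumCLM n f = T.partialSum f n 0 := rfl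

/-- The ideal test function is the phase `D_n / |D_n|`, discontinuous at zeros. The continuous
substitute `D_n / (|D_n| + 1)` costs at most `1`, because `t - 1 ≤ t² / (t + 1)`. -/
lemma dirichletNorm_le_norm_partialSumCLM (n : ℕ) :
    T.dirichletNorm n ≤ ‖T.partialSumCLM n‖ + 1 := by
  set d := T.dirichletKernel n with hd
  have hdc : Continuous d := T.continuous_dirichletKernel n
  have hpos : ∀ y, 0 < ‖d y‖ + 1 := fun y => by positivity
  have hcast : ∀ y, ((‖d y‖ + 1 : ℝ) : ℂ) ≠ 0 := fun y => by exact_mod_cast (hpos y).ne'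
  have hcont : Continuous fun y => d y / ((‖d y‖ + 1 : ℝ) : ℂ) :=
    hdc.div (by fun_prop) hcast
  have hb : ∀ y, ‖d y / ((‖d y‖ + 1 : ℝ) : ℂ)‖ ≤ 1 := fun y => by
    rw [norm_div, Complex.norm_of_nonneg (hpos y).le, div_le_one (hpos y)]
    linarith
  set f : ℝ →ᵇ ℂ := BoundedContinuousFunction.ofNormedAddCommGroup _ hcont 1 hb with hf
  have hf1 : ‖f‖ ≤ 1 := BoundedContinuousFunction.norm_ofNormedAddCommGroup_le _ zero_le_one hb
  have hval : ∀ y, f y * (starRingEnd ℂ) (d y) = ((‖d y‖ ^ 2 / (‖d y‖ + 1) : ℝ) : ℂ) := fun y => by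
    change d y / ((‖d y‖ + 1 : ℝ) : ℂ) * (starRingEnd ℂ) (d y) = _
    rw [div_mul_eq_mul_div, Complex.mul_conj']
    push_cast; rfl
  have hg0 : ∀ y, 0 ≤ ‖d y‖ ^ 2 / (‖d y‖ + 1) := fun y => by positivity
  have hgc : Continuous fun y => ‖d y‖ ^ 2 / (‖d y‖ + 1) :=
    (hdc.norm.pow 2).div (hdc.norm.add continuous_const) fun y => (hpos y).ne'
  have hgle : ∀ y, ‖d y‖ ^ 2 / (‖d y‖ + 1) ≤ ‖d y‖ := fun y => by
    rw [div_le_iff₀ (hpos y)]; nlinarith [norm_nonneg (d y)]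
  have hgi : Integrable (fun y => ‖d y‖ ^ 2 / (‖d y‖ + 1)) T.mu :=
    (T.integrable_dirichletKernel n).mono' hgc.aestronglyMeasurable
      (Eventually.of_forall fun y => by rw [Real.norm_of_nonneg (hg0 y)]; exact hgle y)
  have h1 : ∫ y, ‖d y‖ ^ 2 / (‖d y‖ + 1) ∂T.mu ≤ ‖T.partialSumCLM n‖ := by
    have h2 := (T.partialSumCLM n).le_opNorm f
    rw [partialSumCLM_apply, partialSum_zero, ← hd] at h2
    simp only [hval] at h2
    rw [integral_complex_ofReal, Complex.norm_of_nonneg (integral_nonneg hg0)] at h2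
    exact h2.trans (mul_le_of_le_one_right (norm_nonneg _) hf1)
  have h3 : T.dirichletNorm n ≤ ∫ y, (‖d y‖ ^ 2 / (‖d y‖ + 1) + 1) ∂T.mu := by
    refine integral_mono (T.integrable_dirichletKernel n) (hgi.add (integrable_const 1)) fun y => ?_
    change ‖d y‖ ≤ ‖d y‖ ^ 2 / (‖d y‖ + 1) + 1
    rw [← sub_le_iff_le_add, le_div_iff₀ (hpos y)]
    linarith
  rw [integral_add hgi (integrable_const 1)] at h3
  simp only [integral_const, probReal_univ, one_smul] at h3
  linarith

lemma exists_unbounded_partialSum (h : ¬ ∃ M : ℝ, ∀ n, T.dirichletNorm n ≤ M) :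
    ∃ f : ℝ →ᵇ ℂ, ¬ ∃ M : ℝ, ∀ n : ℕ, ‖T.partialSum f n 0‖ ≤ M := by
  by_contra! hall
  obtain ⟨M, hM⟩ := banach_steinhaus (g := T.partialSumCLM) hall
  exact h ⟨M + 1, fun n => (T.dirichletNorm_le_norm_partialSumCLM n).trans (by linarith [hM n])⟩

end BanachSteinhaus

end HadamardSystem

theorem theorem3p1 (T : HadamardSystem) :
    ∃ D : ℝ,
      Tendsto (fun n : ℕ => (⨆ x : T.attractor, (T.ruelle^[n] fun _ => 1) x) ^ (1 / (n : ℝ)))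
        atTop (𝓝 D) ∧
      (1 < D →
        (∀ ρ : ℝ, 1 < ρ → ρ ≤ D →
          ∃ C : ℝ, 0 < C ∧ ∀ᶠ n : ℕ in atTop, C * ρ ^ n ≤ T.dirichletNorm n) ∧
        ∃ f : ℝ → ℂ, ContinuousOn f T.attractor ∧
          ¬ ∃ M : ℝ, ∀ n : ℕ, ‖T.partialSum f n 0‖ ≤ M) ∧
      ((∃ ρ : ℝ, 1 < ρ ∧ ∃ C : ℝ, 0 < C ∧
          ∀ᶠ n : ℕ in atTop, C * ρ ^ n ≤ T.dirichletNorm n) →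
        1 < D) := by
  obtain ⟨D, hD1, hlim, hpow⟩ := T.exists_growth_rate
  refine ⟨D, hlim, fun hD => ⟨fun ρ hρ hρD => ?_, ?_⟩, ?_⟩
  · obtain ⟨C, hC, h⟩ := T.exists_mul_pow_le_dirichletNorm hD hlim hpow
    refine ⟨C, hC, Eventually.of_forall fun n => le_trans ?_ (h n)⟩
    gcongr
  · obtain ⟨C, hC, h⟩ := T.exists_mul_pow_le_dirichletNorm hD hlim hpow
    obtain ⟨f, hf⟩ := T.exists_unbounded_partialSum fun ⟨M, hM⟩ => by
      obtain ⟨n, hn⟩ := pow_unbounded_of_one_lt (M / C) hD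
      rw [div_lt_iff₀' hC] at hn
      linarith [h n, hM n]
    exact ⟨f, f.continuous.continuousOn, hf⟩
  · rintro ⟨ρ, hρ, C, hC, h⟩
    by_contra hlt
    -- If `D ≤ 1 < ρ`, then `ρ^{-n} sup R_L^n 1` tends to `0`, while the assumed growth keeps `#Λ_0`
    -- times it above `C`.
    have hDρ : D < ρ := by linarith
    have hs := (T.summable_supIter hDρ (by linarith) hlim).tendsto_atTop_zero.const_mul
      ((T.finite_freq 0).toFinset.card : ℝ)
    rw [mul_zero] at hs
    have hle : C ≤ 0 := ge_of_tendsto hs (h.mono fun n hn => by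
      have h1 := hn.trans (T.dirichletNorm_le n)
      rw [← le_div_iff₀ (by positivity)] at h1
      refine h1.trans (le_of_eq ?_)
      rw [inv_pow]; ring)
    linarith
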